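/- Let $(X,\Sigma,\mu)$ be a $\sigma$-finite measure space and write $|E|=\mu(E)$. A basis $\mathcal B$ is a collection of sets $B\in\Sigma$ with $0<|B|<\infty$ that covers $X$ up to a set of measure zero. A weight associated to $\mathcal B$ is a measurable function $w\colon X\to[0,\infty)$ with $0<w(B)<\infty$ for all $B\in\mathcal B$, where $w(E)=\int_E w\,d\mu$. Put $w_B=w(B)/|B|$, $m(w;B)=\inf\{t: |\{x\in B: w(x)>t\}|<|B|/2\}$, and $\mathcal M_{\mathcal B}f(x)=\sup_{x\in B\in\mathcal B}\frac1{|B|}\int_B f\,d\mu$. Consider the following twelve conditions, in which every inequality is required for all $B\in\mathcal B$ (and all measurable $E\subset B$ where $E$ occurs), with $\log 0=-\infty$, $\exp(-\infty)=0$, and $0^{a}=\infty$ for $a<0$: - (P1) there exist $p\in(1,\infty)$, $C>0$ with $\big(\frac1{|B|}\int_B w\,d\mu\big)\big(\frac1{|B|}\int_B w^{1-p'}\,d\mu\big)^{p-1}\le C$, where $\frac1p+\frac1{p'}=1$; - (P1') there exist $\delta,C>0$ with $\frac{|E|}{|B|}\le C\big(\frac{w(E)}{w(B)}\big)^{\delta}$;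 - (P2) there exists $C>0$ with $w_B\le C\exp\big(\frac1{|B|}\int_B\log w\,d\mu\big)$; - (P2') there exists $C>0$ with $w_B\le C\big(\frac1{|B|}\int_B w^s\,d\mu\big)^{1/s}$ for every $s\in(0,1)$; - (P3) there exist $q\in(1,\infty)$, $C>0$ with $\big(\frac1{|B|}\int_B w^q\,d\mu\big)^{1/q}\le C\,w_B$; - (P3') there exist $\delta,C>0$ with $\frac{w(E)}{w(B)}\le C\big(\frac{|E|}{|B|}\big)^{\delta}$; - (P4) there exist $\alpha,\beta\in(0,1)$ such that $|E|<\alpha|B|$ implies $w(E)\le\beta w(B)$; - (P4') there exist $\alpha,\beta\in(0,1)$ with $|\{x\in B: w(x)\le\alpha w_B\}|\le\beta|B|$; - (P5) there exists $C>0$ with $w_B\le C\,m(w;B)$; - (P6) there exists $C>0$ with $\int_B w\log^+\frac{w}{w_B}\,d\mu\le C\,w(B)$; - (P7) there exists $C>0$ with $\int_B\mathcal M_{\mathcal B}(w\chi_B)\,d\mu\le C\,w(B)$; - (P8) there exist $C,\beta>0$ with $w(\{x\in B:w(x)\ge\lambda\})\le C\lambda\,|\{x\in B: w(x)\ge\beta\lambda\}|$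 for every $\lambda>w_B$. Say that (PA) $\Rightarrow$ (PB) holds for general bases if, for every $\sigma$-finite measure space, every basis $\mathcal B$ in it and every weight $w$ associated to $\mathcal B$, (PA) for $w$ implies (PB) for $w$. Then, for any two of the twelve conditions, (PA) $\Rightarrow$ (PB) holds for general bases if and only if it follows, by reflexivity and transitivity, from the equivalences (P1) $\Leftrightarrow$ (P1'), (P2) $\Leftrightarrow$ (P2'), (P3) $\Leftrightarrow$ (P3'), (P4) $\Leftrightarrow$ (P4') and the implications (P1) $\Rightarrow$ (P2) $\Rightarrow$ (P5) $\Rightarrow$ (P4) and (P8) $\Rightarrow$ (P3) $\Rightarrow$ (P6) $\Rightarrow$ (P4). Every other implication (PA) $\Rightarrow$ (PB) fails, and it fails for some $\sigma$-finite measure space, basis $\mathcal B$ and weight $w$ for which all the functions $\mathcal M_{\mathcal B}(w\chi_B)$, $B\in\mathcal B$, are measurable. In particular, none of the other eleven conditions implies (P7), (P7) implies none of them, and (P5) does not imply (P2). -/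

import Mathlib

open MeasureTheory Set
open scoped ENNReal NNReal

namespace AInfinity

/-- A basis in a measure space: a family of measurable sets of positive finite measure that covers
the space up to a set of measure zero. -/
structure IsBasis {X : Type*} [MeasurableSpace X] (μ : Measure X) (𝓑 : Set (Set X)) : Prop where
  measurableSet : ∀ B ∈ 𝓑, MeasurableSet B
  measure_pos : ∀ B ∈ 𝓑, 0 < μ B
  measure_lt_top : ∀ B ∈ 𝓑, μ B < ∞
  cover : μ (⋃₀ 𝓑)ᶜ = 0

/-- `wMeas μ w E` is the integral `w(E) = ∫_E w dμ`. -/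
noncomputable def wMeas {X : Type*} [MeasurableSpace X] (μ : Measure X) (w : X → ℝ≥0)
    (E : Set X) : ℝ≥0∞ :=
  ∫⁻ x in E, (w x : ℝ≥0∞) ∂μ

/-- A weight associated to `𝓑`: a measurable function with values in `[0, ∞)` whose integral over
each member of `𝓑` is finite and positive (it is divided by in the conditions below). -/
structure IsWeight {X : Type*} [MeasurableSpace X] (μ : Measure X) (𝓑 : Set (Set X))
    (w : X → ℝ≥0) : Prop where
  measurable : Measurable w
  integral_pos : ∀ B ∈ 𝓑, 0 < wMeas μ w B
  integral_lt_top : ∀ B ∈ 𝓑, wMeas μ w B < ∞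

/-- The average over `B` of a function with values in `[0, ∞]`. -/
noncomputable def avg {X : Type*} [MeasurableSpace X] (μ : Measure X) (B : Set X)
    (f : X → ℝ≥0∞) : ℝ≥0∞ :=
  (∫⁻ x in B, f x ∂μ) / μ B

/-- The average `w_B = w(B) / |B|`. -/
noncomputable def wAvg {X : Type*} [MeasurableSpace X] (μ : Measure X) (w : X → ℝ≥0)
    (B : Set X) : ℝ≥0∞ :=
  wMeas μ w B / μ B

/-- The median `m(w; B) = inf {t : |{x ∈ B : w(x) > t}| < |B| / 2}`. -/
noncomputable def median {X : Type*} [MeasurableSpace X] (μ : Measure X) (w : X → ℝ≥0)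
    (B : Set X) : ℝ≥0∞ :=
  sInf {t : ℝ≥0∞ | μ {x ∈ B | t < (w x : ℝ≥0∞)} < μ B / 2}

/-- The integral over `B` of an extended real function, positive part minus negative part. -/
noncomputable def extIntegral {X : Type*} [MeasurableSpace X] (μ : Measure X) (B : Set X)
    (f : X → EReal) : EReal :=
  ((∫⁻ x in B, (f x).toENNReal ∂μ : ℝ≥0∞) : EReal)
    - ((∫⁻ x in B, (-f x).toENNReal ∂μ : ℝ≥0∞) : EReal)

/-- `exp ((1/|B|) ∫_B log w dμ)`, with `log 0 = -∞` and `exp (-∞) = 0`. -/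
noncomputable def geomMean {X : Type*} [MeasurableSpace X] (μ : Measure X) (w : X → ℝ≥0)
    (B : Set X) : ℝ≥0∞ :=
  EReal.exp (extIntegral μ B (fun x => ENNReal.log (w x : ℝ≥0∞)) / ((μ B : ℝ≥0∞) : EReal))

/-- The maximal operator associated to `𝓑`, on functions with values in `[0, ∞]`. -/
noncomputable def maximalOp {X : Type*} [MeasurableSpace X] (μ : Measure X) (𝓑 : Set (Set X))
    (f : X → ℝ≥0∞) (x : X) : ℝ≥0∞ :=
  ⨆ B ∈ 𝓑, ⨆ _ : x ∈ B, avg μ B f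

/-- The function `M_𝓑 (w χ_B)`. -/
noncomputable def localMaximal {X : Type*} [MeasurableSpace X] (μ : Measure X) (𝓑 : Set (Set X))
    (w : X → ℝ≥0) (B : Set X) : X → ℝ≥0∞ :=
  maximalOp μ 𝓑 (B.indicator fun x => (w x : ℝ≥0∞))

/-- The names of the twelve conditions. -/
inductive Condition
  | P1 | P1' | P2 | P2' | P3 | P3' | P4 | P4' | P5 | P6 | P7 | P8

/-- The twelve `A_∞` conditions for a weight `w` associated to the basis `𝓑`. -/
def Condition.Holds {X : Type*} [MeasurableSpace X] (μ : Measure X) (𝓑 : Set (Set X))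
    (w : X → ℝ≥0) : Condition → Prop
  | .P1 => ∃ p : ℝ, 1 < p ∧ ∃ C : ℝ≥0, 0 < C ∧ ∀ B ∈ 𝓑,
      avg μ B (fun x => (w x : ℝ≥0∞))
        * avg μ B (fun x => (w x : ℝ≥0∞) ^ (1 - Real.conjExponent p)) ^ (p - 1) ≤ C
  | .P1' => ∃ δ : ℝ, 0 < δ ∧ ∃ C : ℝ≥0, 0 < C ∧ ∀ B ∈ 𝓑, ∀ E ⊆ B, MeasurableSet E →
      μ E / μ B ≤ C * (wMeas μ w E / wMeas μ w B) ^ δ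
  | .P2 => ∃ C : ℝ≥0, 0 < C ∧ ∀ B ∈ 𝓑,
      avg μ B (fun x => (w x : ℝ≥0∞)) ≤ C * geomMean μ w B
  | .P2' => ∃ C : ℝ≥0, 0 < C ∧ ∀ s : ℝ, 0 < s → s < 1 → ∀ B ∈ 𝓑,
      avg μ B (fun x => (w x : ℝ≥0∞)) ≤ C * avg μ B (fun x => (w x : ℝ≥0∞) ^ s) ^ (1 / s)
  | .P3 => ∃ q : ℝ, 1 < q ∧ ∃ C : ℝ≥0, 0 < C ∧ ∀ B ∈ 𝓑,
      avg μ B (fun x => (w x : ℝ≥0∞) ^ q) ^ (1 / q) ≤ C * avg μ B (fun x => (w x : ℝ≥0∞))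
  | .P3' => ∃ δ : ℝ, 0 < δ ∧ ∃ C : ℝ≥0, 0 < C ∧ ∀ B ∈ 𝓑, ∀ E ⊆ B, MeasurableSet E →
      wMeas μ w E / wMeas μ w B ≤ C * (μ E / μ B) ^ δ
  | .P4 => ∃ α β : ℝ≥0, 0 < α ∧ α < 1 ∧ 0 < β ∧ β < 1 ∧ ∀ B ∈ 𝓑, ∀ E ⊆ B, MeasurableSet E →
      μ E < α * μ B → wMeas μ w E ≤ β * wMeas μ w B
  | .P4' => ∃ α β : ℝ≥0, 0 < α ∧ α < 1 ∧ 0 < β ∧ β < 1 ∧ ∀ B ∈ 𝓑,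
      μ {x ∈ B | (w x : ℝ≥0∞) ≤ α * wAvg μ w B} ≤ β * μ B
  | .P5 => ∃ C : ℝ≥0, 0 < C ∧ ∀ B ∈ 𝓑, wAvg μ w B ≤ C * median μ w B
  | .P6 => ∃ C : ℝ≥0, 0 < C ∧ ∀ B ∈ 𝓑,
      ∫⁻ x in B, (w x : ℝ≥0∞) * ENNReal.ofReal (Real.posLog ((w x : ℝ) / (wAvg μ w B).toReal)) ∂μ
        ≤ C * wMeas μ w B
  | .P7 => ∃ C : ℝ≥0, 0 < C ∧ ∀ B ∈ 𝓑,
      ∫⁻ x in B, localMaximal μ 𝓑 w B x ∂μ ≤ C * wMeas μ w B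
  | .P8 => ∃ C β : ℝ≥0, 0 < C ∧ 0 < β ∧ ∀ B ∈ 𝓑, ∀ l : ℝ≥0, wAvg μ w B < (l : ℝ≥0∞) →
      wMeas μ w {x ∈ B | l ≤ w x} ≤ C * l * μ {x ∈ B | β * l ≤ w x}

/-- The unprimed representative of each condition. -/
def Condition.base : Condition → Condition
  | .P1' => .P1
  | .P2' => .P2
  | .P3' => .P3
  | .P4' => .P4
  | A => A

/-- The rows of the table of implications: the unprimed conditions implied by each unprimed
condition (a primed condition has the row of its unprimed form). -/
def Condition.row (A : Condition) : Set Condition :=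
  match A.base with
  | .P1 => {.P1, .P2, .P4, .P5}
  | .P2 => {.P2, .P4, .P5}
  | .P3 => {.P3, .P4, .P6}
  | .P4 => {.P4}
  | .P5 => {.P4, .P5}
  | .P6 => {.P4, .P6}
  | .P7 => {.P7}
  | .P8 => {.P3, .P4, .P6, .P8}
  | _ => ∅

/-- The entry of the table at `(A, B)` is a check mark (or the equality sign). -/
def Condition.TableEntry (A B : Condition) : Prop :=
  B.base ∈ A.row

end AInfinity

/-!
All conditions are scale invariant, so on each basis set `B` they are statements about the
probability measure `ν = μ(· ∩ B) / μ(B)` and the weight, with constants not depending on `B`.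

**The implications.** Two of them follow from Hölder's inequality for `1 = w ^ t * w ^ (-t)`: it
turns `(P1)` into `(P1')` and into `(P2')`. The implications `(P1') → (P1)`, `(P3') → (P3)` and
`(P8) → (P3)` all use `exists_lintegral_rpow_le_of_geometric_tail`: a geometrically decaying
distribution function gives a bound for the integral of a small power. In the first two the decay is
the hypothesis tested on a level set of `w`; for `(P8)` it comes from adding the hypothesis over
the levels `2 ^ k * l` (`nsmul_setLIntegral_le_of_P8`), where the right-hand sides form a geometric
series at each point. `(P2) → (P2')` is Jensen's inequality, and `(P2') → (P2)` lets the exponent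
tend to zero by Fatou's lemma. The implications into `(P4)`, `(P4')` and `(P5)` split the basis
set at a level of the weight proportional to its average, and `(P3) → (P6)` bounds the logarithm by a
power.

**The counterexamples.** Two-point basis sets that are pairwise disjoint, with masses `1 - θ n`,
`θ n` and weight values `a n`, `b n`, refute every implication not ending in `(P7)`, up to
transitivity:

* `(P1)` without `(P6)`: `a = 1`, `b = 2 ^ n`, `θ = 2 ^ (-n)`;
* `(P2)` without `(P1)`: `a = 1`, `b = 2 ^ (-n)`, `θ = 1 / n`;
* `(P5)` without `(P2)`: `a = 1`, `b = 0`, `θ = 1 / 4`, as a zero of `w` kills the geometric mean;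
* `(P8)` without `(P5)`: `a = 0`, `b = 1`, `θ = 1 / 4`, whose median is zero;
* `(P3)` without `(P8)`: `a = 1`, `b = 4 ^ n`, `θ = 16 ^ (-n)`, tested at levels between `a` and `b`;
* `(P6)` without `(P3)`: `a = 1`, `b = 2 ^ n`, `θ = 2 ^ (-n) / n`;
* `(P7)` without `(P4)`: `a = 0`, `b = 1`, `θ = 1 / n`, as `(P7)` is trivial for a disjoint basis.

A single basis with overlapping sets, on the space `Layers`, satisfies `(P1)` and `(P8)` but not
`(P7)`: many small satellites share the heavy core point of their layer, so that the maximal function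
is large on a set that carries little weight. All spaces are discrete and countable, so
measurability is automatic.
-/

namespace AInfinity

/-! ### Normalization to probability measures -/

section Normalized

variable {X : Type*} [MeasurableSpace X] {μ : Measure X} {𝓑 : Set (Set X)} {w : X → ℝ≥0}
  {B E : Set X}

theorem avg_eq_lintegral_cond (f : X → ℝ≥0∞) :
    avg μ B f = ∫⁻ x, f x ∂(ProbabilityTheory.cond μ B) := by
  rw [avg, ProbabilityTheory.cond, lintegral_smul_measure, ENNReal.div_eq_inv_mul, smul_eq_mul]

theorem wAvg_eq_lintegral_cond :
    wAvg μ w B = ∫⁻ x, (w x : ℝ≥0∞) ∂(ProbabilityTheory.cond μ B) :=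
  avg_eq_lintegral_cond _

theorem IsBasis.isProbabilityMeasure_cond (h𝓑 : IsBasis μ 𝓑) (hB : B ∈ 𝓑) :
    IsProbabilityMeasure (ProbabilityTheory.cond μ B) :=
  ProbabilityTheory.cond_isProbabilityMeasure_of_finite (h𝓑.measure_pos B hB).ne'
    (h𝓑.measure_lt_top B hB).ne

theorem IsWeight.lintegral_cond_ne_zero (h𝓑 : IsBasis μ 𝓑) (hw : IsWeight μ 𝓑 w) (hB : B ∈ 𝓑) :
    ∫⁻ x, (w x : ℝ≥0∞) ∂(ProbabilityTheory.cond μ B) ≠ 0 := by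
  rw [← wAvg_eq_lintegral_cond, wAvg]
  exact (ENNReal.div_pos (hw.integral_pos B hB).ne' (h𝓑.measure_lt_top B hB).ne).ne'

theorem IsWeight.lintegral_cond_ne_top (h𝓑 : IsBasis μ 𝓑) (hw : IsWeight μ 𝓑 w) (hB : B ∈ 𝓑) :
    ∫⁻ x, (w x : ℝ≥0∞) ∂(ProbabilityTheory.cond μ B) ≠ ∞ := by
  rw [← wAvg_eq_lintegral_cond, wAvg]
  exact ENNReal.div_ne_top (hw.integral_lt_top B hB).ne (h𝓑.measure_pos B hB).ne'

theorem IsBasis.measure_eq (h𝓑 : IsBasis μ 𝓑) (hB : B ∈ 𝓑) (hE : E ⊆ B) :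
    μ E = μ B * ProbabilityTheory.cond μ B E := by
  rw [ProbabilityTheory.cond_apply (h𝓑.measurableSet B hB), inter_eq_self_of_subset_right hE,
    ← mul_assoc, ENNReal.mul_inv_cancel (h𝓑.measure_pos B hB).ne' (h𝓑.measure_lt_top B hB).ne,
    one_mul]

theorem IsBasis.measure_div_eq (h𝓑 : IsBasis μ 𝓑) (hB : B ∈ 𝓑) (hE : E ⊆ B) :
    μ E / μ B = ProbabilityTheory.cond μ B E := by
  rw [ProbabilityTheory.cond_apply (h𝓑.measurableSet B hB), inter_eq_self_of_subset_right hE,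
    ENNReal.div_eq_inv_mul]

theorem IsBasis.wMeas_eq (h𝓑 : IsBasis μ 𝓑) (hB : B ∈ 𝓑) (hE : E ⊆ B) :
    wMeas μ w E = μ B * ∫⁻ x in E, (w x : ℝ≥0∞) ∂(ProbabilityTheory.cond μ B) := by
  rw [ProbabilityTheory.cond, Measure.restrict_smul, Measure.restrict_restrict_of_subset hE,
    lintegral_smul_measure, smul_eq_mul, ← mul_assoc,
    ENNReal.mul_inv_cancel (h𝓑.measure_pos B hB).ne' (h𝓑.measure_lt_top B hB).ne, one_mul, wMeas]

theorem IsBasis.wMeas_self_eq (h𝓑 : IsBasis μ 𝓑) (hB : B ∈ 𝓑) :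
    wMeas μ w B = μ B * ∫⁻ x, (w x : ℝ≥0∞) ∂(ProbabilityTheory.cond μ B) := by
  rw [← wAvg_eq_lintegral_cond, wAvg,
    ENNReal.mul_div_cancel (h𝓑.measure_pos B hB).ne' (h𝓑.measure_lt_top B hB).ne]

theorem IsBasis.wMeas_div_eq (h𝓑 : IsBasis μ 𝓑) (hB : B ∈ 𝓑) (hE : E ⊆ B) :
    wMeas μ w E / wMeas μ w B = (∫⁻ x in E, (w x : ℝ≥0∞) ∂(ProbabilityTheory.cond μ B)) /
      ∫⁻ x, (w x : ℝ≥0∞) ∂(ProbabilityTheory.cond μ B) := by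
  rw [h𝓑.wMeas_eq hB hE, h𝓑.wMeas_self_eq hB,
    ENNReal.mul_div_mul_left _ _ (h𝓑.measure_pos B hB).ne' (h𝓑.measure_lt_top B hB).ne]

theorem IsBasis.cond_sep (h𝓑 : IsBasis μ 𝓑) (hB : B ∈ 𝓑) (p : X → Prop) :
    ProbabilityTheory.cond μ B {x ∈ B | p x} = ProbabilityTheory.cond μ B {x | p x} :=
  ProbabilityTheory.cond_inter_self (h𝓑.measurableSet B hB) {x | p x} μ

theorem IsBasis.setLIntegral_cond_sep (h𝓑 : IsBasis μ 𝓑) (hB : B ∈ 𝓑) (p : X → Prop)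
    (f : X → ℝ≥0∞) :
    ∫⁻ x in {x ∈ B | p x}, f x ∂(ProbabilityTheory.cond μ B) =
      ∫⁻ x in {x | p x}, f x ∂(ProbabilityTheory.cond μ B) := by
  rw [ProbabilityTheory.cond, Measure.restrict_smul, Measure.restrict_smul,
    Measure.restrict_restrict_of_subset (sep_subset B p),
    Measure.restrict_restrict' (h𝓑.measurableSet B hB), inter_comm]
  rfl

end Normalized

/-! ### Power integrals and Hölder's inequality -/

section Probability

variable {X : Type*} [MeasurableSpace X]

theorem exists_rpow_mul_lt_one {a ρ : ℝ≥0} (ha : 1 < a) (hρ : ρ < 1) :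
    ∃ r : ℝ, 0 < r ∧ r < 1 ∧ a ^ r * ρ < 1 := by
  have hc : Continuous fun r : ℝ => (a : ℝ) ^ r * ρ :=
    (Real.continuous_const_rpow (by positivity)).mul continuous_const
  have h1 : ∀ᶠ r in nhds (0 : ℝ), (a : ℝ) ^ r * ρ < 1 :=
    hc.continuousAt.eventually_lt continuousAt_const (by simpa using hρ)
  have h2 : ∀ᶠ r in nhdsWithin (0 : ℝ) (Ioi 0), (a : ℝ) ^ r * ρ < 1 := nhdsWithin_le_nhds h1
  obtain ⟨r, hr, hr'⟩ := (h2.and (Ioo_mem_nhdsGT one_pos)).exists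
  exact ⟨r, hr'.1, hr'.2, by exact_mod_cast hr⟩

/-- A function whose distribution function decays geometrically along a geometric sequence of
levels has a power-integral bound: sum over the level sets. -/
theorem exists_lintegral_rpow_le_of_geometric_tail (X : Type*) [MeasurableSpace X] {a ρ : ℝ≥0}
    (ha : 1 < a) (hρ : ρ < 1) (C : ℝ≥0) :
    ∃ r : ℝ, 0 < r ∧ ∃ K : ℝ≥0, 0 < K ∧ ∀ (ν : Measure X) [IsProbabilityMeasure ν]
      (f : X → ℝ≥0∞), Measurable f → (∀ k : ℕ, ν {x | (a : ℝ≥0∞) ^ k ≤ f x} ≤ C * ρ ^ k) →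
      ∫⁻ x, f x ^ r ∂ν ≤ K := by
  obtain ⟨r, hr, -, hlt⟩ := exists_rpow_mul_lt_one ha hρ
  set b : ℝ≥0 := a ^ r with hb
  have hb1 : 1 ≤ b := NNReal.one_le_rpow ha.le hr.le
  refine ⟨r, hr, 1 + b * C * (1 - b * ρ)⁻¹, by positivity, fun ν _ f hf htail => ?_⟩
  have hpow (k : ℕ) : ((a : ℝ≥0∞) ^ k) ^ r = (b : ℝ≥0∞) ^ k := by
    rw [hb, ENNReal.coe_rpow_of_nonneg _ hr.le, ← ENNReal.rpow_natCast, ← ENNReal.rpow_natCast,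
      ← ENNReal.rpow_mul, ← ENNReal.rpow_mul, mul_comm]
  have hm (k : ℕ) : MeasurableSet {x | (a : ℝ≥0∞) ^ k ≤ f x} := measurableSet_le measurable_const hf
  have hpt (x : X) : f x ^ r ≤ 1 + ∑' k : ℕ,
      {x | (a : ℝ≥0∞) ^ k ≤ f x}.indicator (fun _ => (b : ℝ≥0∞) ^ (k + 1)) x := by
    rcases le_total (f x) 1 with h | h
    · exact (ENNReal.rpow_le_one h hr.le).trans le_self_add
    rcases eq_or_ne (f x) ∞ with htop | htop
    · have hs : ∑' k : ℕ,
          {x | (a : ℝ≥0∞) ^ k ≤ f x}.indicator (fun _ => (b : ℝ≥0∞) ^ (k + 1)) x = ∞ := by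
        refine top_unique ?_
        rw [← ENNReal.tsum_const_eq_top_of_ne_zero (α := ℕ) one_ne_zero]
        refine ENNReal.tsum_le_tsum fun k => ?_
        rw [indicator_of_mem (by simp [htop])]
        exact one_le_pow₀ (by exact_mod_cast hb1)
      rw [hs]; simp
    · lift f x to ℝ≥0 using htop with y hy
      obtain ⟨k, hk, hk'⟩ := exists_nat_pow_near (show (1 : ℝ≥0) ≤ y by exact_mod_cast h) ha
      refine le_trans ?_ le_add_self
      refine le_trans ?_ (ENNReal.le_tsum k)
      rw [indicator_of_mem (by rw [mem_ofPred_eq, ← hy]; exact_mod_cast hk), ← hpow]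
      exact ENNReal.rpow_le_rpow (by exact_mod_cast hk'.le) hr.le
  calc ∫⁻ x, f x ^ r ∂ν
      ≤ ∫⁻ x, (1 + ∑' k : ℕ,
          {x | (a : ℝ≥0∞) ^ k ≤ f x}.indicator (fun _ => (b : ℝ≥0∞) ^ (k + 1)) x) ∂ν :=
        lintegral_mono hpt
    _ = 1 + ∑' k : ℕ, (b : ℝ≥0∞) ^ (k + 1) * ν {x | (a : ℝ≥0∞) ^ k ≤ f x} := by
        rw [lintegral_add_left measurable_const, lintegral_tsum
          fun k => (measurable_const.indicator (hm k)).aemeasurable]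
        simp_rw [lintegral_indicator_const (hm _)]
        simp
    _ ≤ 1 + ∑' k : ℕ, (b * C : ℝ≥0∞) * ((b * ρ : ℝ≥0) : ℝ≥0∞) ^ k := by
        refine add_le_add le_rfl (ENNReal.tsum_le_tsum fun k => ?_)
        refine (mul_le_mul' le_rfl (htail k)).trans_eq ?_
        push_cast
        ring
    _ = ((1 + b * C * (1 - b * ρ)⁻¹ : ℝ≥0) : ℝ≥0∞) := by
        rw [ENNReal.tsum_mul_left, ENNReal.tsum_geometric, ENNReal.coe_add,
          ENNReal.coe_mul _ (1 - b * ρ)⁻¹, ENNReal.coe_inv (tsub_pos_of_lt hlt).ne',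
          ENNReal.coe_sub, ENNReal.coe_mul b C, ENNReal.coe_one]

/-- Hölder's inequality for `1 = w ^ t * w ^ (-t)`. The finiteness hypothesis excludes the
product `0 * ∞` at zeros of `w`. -/
theorem measure_le_lintegral_rpow_mul_lintegral_rpow_neg {ν : Measure X}
    {w : X → ℝ≥0} (hw : Measurable w) {s r : ℝ} (hs : 0 < s) (hr : 0 < r)
    (hfin : ∫⁻ x, (w x : ℝ≥0∞) ^ (-r) ∂ν ≠ ∞) {E : Set X} :
    ν E ≤ (∫⁻ x in E, (w x : ℝ≥0∞) ^ s ∂ν) ^ (r / (s + r)) *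
      (∫⁻ x, (w x : ℝ≥0∞) ^ (-r) ∂ν) ^ (s / (s + r)) := by
  have hw' : Measurable fun x => (w x : ℝ≥0∞) := hw.coe_nnreal_ennreal
  set t : ℝ := s * r / (s + r) with ht
  have htpos : 0 < t := by positivity
  have hpos : ∀ᵐ x ∂ν, (w x : ℝ≥0∞) ≠ 0 := by
    filter_upwards [ae_lt_top (hw'.pow_const (-r)) hfin] with x hx h0
    rw [h0, ENNReal.zero_rpow_of_neg (by linarith)] at hx
    exact lt_irrefl _ hx
  have hconj : (s / t).HolderConjugate (r / t) := by
    rw [Real.holderConjugate_iff]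
    constructor
    · rw [lt_div_iff₀ htpos, ht, one_mul, div_lt_iff₀ (by positivity)]; nlinarith
    · rw [ht]; field_simp; ring
  have h1 : ν E = ∫⁻ x in E, ((fun x => (w x : ℝ≥0∞) ^ t) * fun x => (w x : ℝ≥0∞) ^ (-t)) x ∂ν := by
    rw [← setLIntegral_one]
    refine lintegral_congr_ae (ae_restrict_of_ae ?_)
    filter_upwards [hpos] with x hx
    rw [Pi.mul_apply, ← ENNReal.rpow_add _ _ hx ENNReal.coe_ne_top, add_neg_cancel,
      ENNReal.rpow_zero]
  rw [h1]
  refine (ENNReal.lintegral_mul_le_Lp_mul_Lq _ hconj (hw'.pow_const _).aemeasurable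
    (hw'.pow_const _).aemeasurable).trans ?_
  have e1 : t * (s / t) = s := by field_simp
  have e2 : -t * (r / t) = -r := by field_simp
  have e3 : 1 / (s / t) = r / (s + r) := by rw [ht]; field_simp
  have e4 : 1 / (r / t) = s / (s + r) := by rw [ht]; field_simp
  simp_rw [← ENNReal.rpow_mul, e1, e2, e3, e4]
  gcongr
  exact Measure.restrict_le_self

end Probability

/-! ### The conditions `(P1)`, `(P1')`, `(P3)`, `(P3')` -/

section Implications

variable {X : Type*} [MeasurableSpace X] {μ : Measure X} {𝓑 : Set (Set X)} {w : X → ℝ≥0}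

theorem IsWeight.measurable_coe (hw : IsWeight μ 𝓑 w) : Measurable fun x => (w x : ℝ≥0∞) :=
  hw.measurable.coe_nnreal_ennreal

theorem one_sub_conjExponent_one_add_inv {r : ℝ} (hr : 0 < r) :
    1 - Real.conjExponent (1 + 1 / r) = -r := by
  rw [Real.conjExponent]; field_simp; ring

/-- `(P1)` with the exponent written as `p = 1 + 1 / r`. -/
theorem holds_P1_iff :
    Condition.P1.Holds μ 𝓑 w ↔ ∃ r : ℝ, 0 < r ∧ ∃ C : ℝ≥0, 0 < C ∧ ∀ B ∈ 𝓑,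
      (∫⁻ x, (w x : ℝ≥0∞) ∂(ProbabilityTheory.cond μ B)) *
        (∫⁻ x, (w x : ℝ≥0∞) ^ (-r) ∂(ProbabilityTheory.cond μ B)) ^ (1 / r) ≤ C := by
  simp only [Condition.Holds, avg_eq_lintegral_cond]
  constructor
  · rintro ⟨p, hp, C, hC, h⟩
    refine ⟨1 / (p - 1), by have := sub_pos.2 hp; positivity, C, hC, fun B hB => ?_⟩
    have hp0 : p - 1 ≠ 0 := (sub_pos.2 hp).ne'
    have e : -(1 / (p - 1)) = 1 - Real.conjExponent p := by
      rw [Real.conjExponent]; field_simp; ring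
    rw [e, one_div_one_div]
    exact h B hB
  · rintro ⟨r, hr, C, hC, h⟩
    refine ⟨1 + 1 / r, by simpa using hr, C, hC, fun B hB => ?_⟩
    rw [one_sub_conjExponent_one_add_inv hr, add_sub_cancel_left]
    exact h B hB

/-- The consequence of `(P1)` on a single set: the negative power is integrable. -/
theorem lintegral_rpow_neg_ne_top {ν : Measure X} {r : ℝ} (hr : 0 < r) {C : ℝ≥0}
    (hW : ∫⁻ x, (w x : ℝ≥0∞) ∂ν ≠ 0)
    (h : (∫⁻ x, (w x : ℝ≥0∞) ∂ν) * (∫⁻ x, (w x : ℝ≥0∞) ^ (-r) ∂ν) ^ (1 / r) ≤ C) :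
    ∫⁻ x, (w x : ℝ≥0∞) ^ (-r) ∂ν ≠ ∞ := by
  intro htop
  rw [htop, ENNReal.top_rpow_of_pos (by positivity), ENNReal.mul_top hW] at h
  exact absurd h (by simp)

theorem holds_P1'_of_P1 (h𝓑 : IsBasis μ 𝓑) (hw : IsWeight μ 𝓑 w)
    (h : Condition.P1.Holds μ 𝓑 w) : Condition.P1'.Holds μ 𝓑 w := by
  obtain ⟨r, hr, C, hC, h⟩ := holds_P1_iff.1 h
  refine ⟨r / (1 + r), by positivity, C ^ (r / (1 + r)), by positivity, fun B hB E hE _ => ?_⟩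
  have hW0 := hw.lintegral_cond_ne_zero h𝓑 hB
  have hWt := hw.lintegral_cond_ne_top h𝓑 hB
  rw [h𝓑.measure_div_eq hB hE, h𝓑.wMeas_div_eq hB hE]
  set ν := ProbabilityTheory.cond μ B
  have hfin := lintegral_rpow_neg_ne_top hr hW0 (h B hB)
  refine (measure_le_lintegral_rpow_mul_lintegral_rpow_neg hw.measurable one_pos hr hfin).trans ?_
  simp only [ENNReal.rpow_one]
  have h1 : (∫⁻ x, (w x : ℝ≥0∞) ^ (-r) ∂ν) ^ (1 / r) ≤ C / ∫⁻ x, (w x : ℝ≥0∞) ∂ν := by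
    rw [ENNReal.le_div_iff_mul_le (Or.inl hW0) (Or.inl hWt), mul_comm]
    exact h B hB
  have h2 := ENNReal.rpow_le_rpow h1 (show 0 ≤ r / (1 + r) by positivity)
  rw [← ENNReal.rpow_mul, show 1 / r * (r / (1 + r)) = 1 / (1 + r) by field_simp] at h2
  refine (mul_le_mul' le_rfl h2).trans_eq ?_
  rw [ENNReal.coe_rpow_of_nonneg _ (by positivity), ← ENNReal.mul_rpow_of_nonneg _ _ (by positivity),
    ← ENNReal.mul_rpow_of_nonneg _ _ (by positivity)]
  congr 1
  simp only [div_eq_mul_inv]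
  ring

theorem coe_two_rpow_neg_pow (δ : ℝ) (k : ℕ) :
    (((2 : ℝ≥0∞) ^ k)⁻¹) ^ δ = (((2 : ℝ≥0) ^ (-δ) : ℝ≥0) : ℝ≥0∞) ^ k := by
  rw [ENNReal.coe_rpow_of_ne_zero two_ne_zero, ENNReal.coe_ofNat, ← ENNReal.rpow_natCast, ← ENNReal.rpow_natCast,
    ← ENNReal.rpow_neg, ← ENNReal.rpow_mul, ← ENNReal.rpow_mul]
  congr 1
  ring

theorem two_rpow_neg_lt_one {δ : ℝ} (hδ : 0 < δ) : (2 : ℝ≥0) ^ (-δ) < 1 :=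
  NNReal.rpow_lt_one_of_one_lt_of_neg one_lt_two (neg_lt_zero.2 hδ)

/-- Testing `(P1')` on `{w ≤ 2 ^ (-k) w_B}` bounds the distribution function of `w_B / w`. -/
theorem holds_P1_of_P1' (h𝓑 : IsBasis μ 𝓑) (hw : IsWeight μ 𝓑 w)
    (h : Condition.P1'.Holds μ 𝓑 w) : Condition.P1.Holds μ 𝓑 w := by
  obtain ⟨δ, hδ, C, hC, h⟩ := h
  obtain ⟨r, hr, K, hK, hT⟩ := exists_lintegral_rpow_le_of_geometric_tail X (a := 2) one_lt_two
    (two_rpow_neg_lt_one hδ) C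
  refine holds_P1_iff.2 ⟨r, hr, K ^ (1 / r), by positivity, fun B hB => ?_⟩
  have hW0 := hw.lintegral_cond_ne_zero h𝓑 hB
  have hWt := hw.lintegral_cond_ne_top h𝓑 hB
  have := h𝓑.isProbabilityMeasure_cond hB
  have htail (k : ℕ) : ProbabilityTheory.cond μ B {x | ((2 : ℝ≥0) : ℝ≥0∞) ^ k ≤
      (∫⁻ x, (w x : ℝ≥0∞) ∂(ProbabilityTheory.cond μ B)) / w x} ≤
      C * (((2 : ℝ≥0) ^ (-δ) : ℝ≥0) : ℝ≥0∞) ^ k := by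
    rw [← h𝓑.cond_sep hB, ← h𝓑.measure_div_eq hB (sep_subset _ _), ← coe_two_rpow_neg_pow]
    refine (h B hB _ (sep_subset _ _) ((h𝓑.measurableSet B hB).inter
      (measurableSet_le measurable_const (hw.measurable_coe.const_div _)))).trans ?_
    rw [h𝓑.wMeas_div_eq hB (sep_subset _ _), h𝓑.setLIntegral_cond_sep hB]
    gcongr
    rw [ENNReal.div_le_iff hW0 hWt]
    calc _ ≤ ∫⁻ x in {x | ((2 : ℝ≥0) : ℝ≥0∞) ^ k ≤
          (∫⁻ x, (w x : ℝ≥0∞) ∂(ProbabilityTheory.cond μ B)) / w x},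
          ((2 : ℝ≥0∞) ^ k)⁻¹ * (∫⁻ x, (w x : ℝ≥0∞) ∂(ProbabilityTheory.cond μ B))
            ∂(ProbabilityTheory.cond μ B) := by
          refine setLIntegral_mono' (measurableSet_le measurable_const
            (hw.measurable_coe.const_div _)) fun x hx => ?_
          rw [← ENNReal.div_eq_inv_mul, ENNReal.le_div_iff_mul_le (by simp) (by simp), mul_comm]
          exact ENNReal.mul_le_of_le_div hx
      _ ≤ _ := by
          rw [setLIntegral_const]
          exact mul_le_of_le_one_right' prob_le_one
  have hb := hT _ _ (hw.measurable_coe.const_div _) htail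
  set ν := ProbabilityTheory.cond μ B
  set W := ∫⁻ x, (w x : ℝ≥0∞) ∂ν
  have e : ∫⁻ x, (W / w x) ^ r ∂ν = W ^ r * ∫⁻ x, (w x : ℝ≥0∞) ^ (-r) ∂ν := by
    rw [← lintegral_const_mul _ (hw.measurable_coe.pow_const _)]
    refine lintegral_congr fun x => ?_
    rw [ENNReal.div_rpow_of_nonneg _ _ hr.le, ENNReal.rpow_neg, div_eq_mul_inv]
  rw [e] at hb
  have := ENNReal.rpow_le_rpow hb (show 0 ≤ 1 / r by positivity)
  rwa [ENNReal.mul_rpow_of_nonneg _ _ (by positivity), ← ENNReal.rpow_mul, mul_one_div_cancel hr.ne',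
    ENNReal.rpow_one, ← ENNReal.coe_rpow_of_nonneg _ (by positivity)] at this

theorem holds_P2'_of_P1 (h𝓑 : IsBasis μ 𝓑) (hw : IsWeight μ 𝓑 w)
    (h : Condition.P1.Holds μ 𝓑 w) : Condition.P2'.Holds μ 𝓑 w := by
  obtain ⟨r, hr, C, hC, h⟩ := holds_P1_iff.1 h
  refine ⟨C, hC, fun s hs _ B hB => ?_⟩
  simp only [avg_eq_lintegral_cond]
  have hW0 := hw.lintegral_cond_ne_zero h𝓑 hB
  have := h𝓑.isProbabilityMeasure_cond hB
  specialize h B hB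
  set ν := ProbabilityTheory.cond μ B
  have hfin := lintegral_rpow_neg_ne_top hr hW0 h
  have h1 := measure_le_lintegral_rpow_mul_lintegral_rpow_neg hw.measurable hs hr hfin (E := univ)
  have h2 := ENNReal.rpow_le_rpow h1 (show 0 ≤ (s + r) / (s * r) by positivity)
  rw [measure_univ, ENNReal.one_rpow, ENNReal.mul_rpow_of_nonneg _ _ (by positivity),
    ← ENNReal.rpow_mul, ← ENNReal.rpow_mul, Measure.restrict_univ,
    show r / (s + r) * ((s + r) / (s * r)) = 1 / s by field_simp,
    show s / (s + r) * ((s + r) / (s * r)) = 1 / r by field_simp] at h2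
  calc ∫⁻ x, (w x : ℝ≥0∞) ∂ν ≤ (∫⁻ x, (w x : ℝ≥0∞) ∂ν) *
        ((∫⁻ x, (w x : ℝ≥0∞) ^ s ∂ν) ^ (1 / s) * (∫⁻ x, (w x : ℝ≥0∞) ^ (-r) ∂ν) ^ (1 / r)) :=
        le_mul_of_one_le_right' h2
    _ = ((∫⁻ x, (w x : ℝ≥0∞) ∂ν) * (∫⁻ x, (w x : ℝ≥0∞) ^ (-r) ∂ν) ^ (1 / r)) *
        (∫⁻ x, (w x : ℝ≥0∞) ^ s ∂ν) ^ (1 / s) := by ring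
    _ ≤ _ := by gcongr

theorem holds_P3'_of_P3 (h𝓑 : IsBasis μ 𝓑) (hw : IsWeight μ 𝓑 w)
    (h : Condition.P3.Holds μ 𝓑 w) : Condition.P3'.Holds μ 𝓑 w := by
  obtain ⟨q, hq, C, hC, h⟩ := h
  have hconj := Real.HolderConjugate.conjExponent hq
  refine ⟨1 / Real.conjExponent q, one_div_pos.2 hconj.symm.pos, C, hC, fun B hB E hE hEm => ?_⟩
  have hW0 := hw.lintegral_cond_ne_zero h𝓑 hB
  have hWt := hw.lintegral_cond_ne_top h𝓑 hB
  specialize h B hB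
  rw [h𝓑.measure_div_eq hB hE, h𝓑.wMeas_div_eq hB hE, ENNReal.div_le_iff hW0 hWt]
  simp only [avg_eq_lintegral_cond] at h
  set ν := ProbabilityTheory.cond μ B
  have h1 := ENNReal.lintegral_mul_le_Lp_mul_Lq (ν.restrict E) hconj
    (f := fun x => (w x : ℝ≥0∞)) (g := fun _ => 1) hw.measurable_coe.aemeasurable aemeasurable_const
  simp only [Pi.mul_apply, mul_one, ENNReal.one_rpow, setLIntegral_one] at h1
  refine h1.trans ?_
  calc _ ≤ (C * ∫⁻ x, (w x : ℝ≥0∞) ∂ν) * ν E ^ (1 / Real.conjExponent q) := by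
        gcongr
        refine le_trans ?_ h
        have := hconj.pos
        gcongr
        exact Measure.restrict_le_self
    _ = _ := by ring

/-- Geometric decay of `w {w ≥ a ^ k w_B}` gives the reverse Hölder inequality. -/
theorem holds_P3_of_geometric_tail (h𝓑 : IsBasis μ 𝓑) (hw : IsWeight μ 𝓑 w) {a ρ C : ℝ≥0}
    (ha : 1 < a) (hρ : ρ < 1)
    (h : ∀ B ∈ 𝓑, ∀ k : ℕ, ∫⁻ x in {x | (a : ℝ≥0∞) ^ k ≤
        w x / ∫⁻ x, (w x : ℝ≥0∞) ∂(ProbabilityTheory.cond μ B)},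
        (w x : ℝ≥0∞) ∂(ProbabilityTheory.cond μ B) ≤
        C * ρ ^ k * ∫⁻ x, (w x : ℝ≥0∞) ∂(ProbabilityTheory.cond μ B)) :
    Condition.P3.Holds μ 𝓑 w := by
  obtain ⟨r, hr, K, hK, hT⟩ := exists_lintegral_rpow_le_of_geometric_tail X ha hρ C
  refine ⟨1 + r, by linarith, K ^ (1 / (1 + r)), by positivity, fun B hB => ?_⟩
  simp only [avg_eq_lintegral_cond]
  have hW0 := hw.lintegral_cond_ne_zero h𝓑 hB
  have hWt := hw.lintegral_cond_ne_top h𝓑 hB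
  have := h𝓑.isProbabilityMeasure_cond hB
  specialize h B hB
  set ν := ProbabilityTheory.cond μ B
  set W := ∫⁻ x, (w x : ℝ≥0∞) ∂ν with hWdef
  have hm : Measurable fun x => (w x : ℝ≥0∞) / W := hw.measurable_coe.div_const _
  -- the tail bound is applied in the probability space `W⁻¹ w dν`
  let ν' : Measure X := W⁻¹ • ν.withDensity fun x => (w x : ℝ≥0∞)
  have hν' : IsProbabilityMeasure ν' := by
    constructor
    simp only [ν', Measure.smul_apply, withDensity_apply _ MeasurableSet.univ,
      Measure.restrict_univ, smul_eq_mul, ← hWdef]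
    exact ENNReal.inv_mul_cancel hW0 hWt
  have htail (k : ℕ) : ν' {x | (a : ℝ≥0∞) ^ k ≤ w x / W} ≤ C * ρ ^ k := by
    simp only [ν', Measure.smul_apply, smul_eq_mul]
    rw [withDensity_apply _ (measurableSet_le measurable_const hm), ← ENNReal.div_eq_inv_mul,
      ENNReal.div_le_iff hW0 hWt]
    exact h k
  have hb := hT ν' _ hm htail
  have e : ∫⁻ x, ((w x : ℝ≥0∞) / W) ^ r ∂ν' =
      (∫⁻ x, (w x : ℝ≥0∞) ^ (1 + r) ∂ν) * (W ^ (1 + r))⁻¹ := by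
    simp only [ν', lintegral_smul_measure, smul_eq_mul]
    rw [lintegral_withDensity_eq_lintegral_mul _ hw.measurable_coe (hm.pow_const _),
      ← lintegral_const_mul _ (hw.measurable_coe.mul (hm.pow_const _)),
      ← lintegral_mul_const _ (hw.measurable_coe.pow_const _)]
    refine lintegral_congr fun x => ?_
    rw [Pi.mul_apply, ENNReal.div_rpow_of_nonneg _ _ hr.le, ENNReal.rpow_add _ _ hW0 hWt,
      ENNReal.rpow_add_of_nonneg _ _ zero_le_one hr.le, ENNReal.rpow_one, ENNReal.rpow_one,
      div_eq_mul_inv, ENNReal.mul_inv (Or.inl hW0) (Or.inl hWt)]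
    ring
  rw [e, ← div_eq_mul_inv, ENNReal.div_le_iff (by simp [hW0, hWt])
    (ENNReal.rpow_ne_top_of_nonneg (by positivity) hWt)] at hb
  have := ENNReal.rpow_le_rpow hb (show 0 ≤ 1 / (1 + r) by positivity)
  rwa [ENNReal.mul_rpow_of_nonneg _ _ (by positivity), ← ENNReal.rpow_mul,
    mul_one_div_cancel (by positivity), ENNReal.rpow_one,
    ← ENNReal.coe_rpow_of_nonneg _ (by positivity)] at this

/-- By Markov's inequality `{w ≥ 2 ^ k w_B}` has measure at most `2 ^ (-k) |B|`, which makes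
`(P3')` a geometric decay. -/
theorem holds_P3_of_P3' (h𝓑 : IsBasis μ 𝓑) (hw : IsWeight μ 𝓑 w)
    (h : Condition.P3'.Holds μ 𝓑 w) : Condition.P3.Holds μ 𝓑 w := by
  obtain ⟨δ, hδ, C, hC, h⟩ := h
  refine holds_P3_of_geometric_tail h𝓑 hw (a := 2) one_lt_two (two_rpow_neg_lt_one hδ) (C := C)
    fun B hB k => ?_
  have hW0 := hw.lintegral_cond_ne_zero h𝓑 hB
  have hWt := hw.lintegral_cond_ne_top h𝓑 hB
  have := h𝓑.isProbabilityMeasure_cond hB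
  have hm : Measurable fun x => (w x : ℝ≥0∞) / ∫⁻ x, (w x : ℝ≥0∞) ∂(ProbabilityTheory.cond μ B) :=
    hw.measurable_coe.div_const _
  rw [← ENNReal.div_le_iff hW0 hWt, ← h𝓑.setLIntegral_cond_sep hB,
    ← h𝓑.wMeas_div_eq hB (sep_subset _ _), ← coe_two_rpow_neg_pow]
  refine (h B hB _ (sep_subset _ _) ((h𝓑.measurableSet B hB).inter
    (measurableSet_le measurable_const hm))).trans ?_
  rw [h𝓑.measure_div_eq hB (sep_subset _ _), h𝓑.cond_sep hB]
  gcongr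
  -- Markov's inequality
  have h1 := mul_meas_ge_le_lintegral (μ := ProbabilityTheory.cond μ B) hm ((2 : ℝ≥0∞) ^ k)
  simp only [div_eq_mul_inv] at h1
  rw [lintegral_mul_const _ hw.measurable_coe, ENNReal.mul_inv_cancel hW0 hWt] at h1
  simp only [← div_eq_mul_inv] at h1
  rw [← one_div, ENNReal.le_div_iff_mul_le (by simp) (by simp), mul_comm]
  exact_mod_cast h1

end Implications

/-! ### Chains of implications down to `(P4)` -/

section Implications

variable {X : Type*} [MeasurableSpace X] {μ : Measure X} {𝓑 : Set (Set X)} {w : X → ℝ≥0}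

/-- The dyadic multiples of `t` below `y` add up to at most `2 * y`. -/
theorem sum_indicator_two_pow_le (t y : ℝ≥0∞) (N : ℕ) :
    ∑ k ∈ Finset.range N, (if t * 2 ^ k ≤ y then t * 2 ^ k else 0) ≤ 2 * (if t ≤ y then y else 0) := by
  have hsum (N : ℕ) : ∑ k ∈ Finset.range N, t * (2 : ℝ≥0∞) ^ k ≤ t * 2 ^ N := by
    induction N with
    | zero => simp
    | succ N ih =>
      rw [Finset.sum_range_succ, pow_succ, ← mul_assoc, mul_two]
      gcongr
  induction N with
  | zero => simp
  | succ N ih =>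
    rw [Finset.sum_range_succ]
    by_cases h : t * 2 ^ N ≤ y
    · have ht : t ≤ y := (le_mul_of_one_le_right' (one_le_pow₀ one_le_two)).trans h
      rw [if_pos h, if_pos ht, two_mul]
      refine add_le_add ((Finset.sum_le_sum fun k _ => ?_).trans ((hsum N).trans h)) h
      split_ifs
      · exact le_rfl
      · exact zero_le
    · rw [if_neg h, add_zero]
      exact ih

/-- Summing `(P8)` over the levels `2 ^ k * l`, `k < N`, and exchanging sum and integral: the sum of
the levels below `w x / β` is geometric, hence at most `2 * w x / β`. -/
theorem nsmul_setLIntegral_le_of_P8 {ν : Measure X} (hw : Measurable w) {C β : ℝ≥0} (hβ : 0 < β)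
    (h : ∀ l : ℝ≥0, ∫⁻ x, (w x : ℝ≥0∞) ∂ν < l →
      ∫⁻ x in {x | l ≤ w x}, (w x : ℝ≥0∞) ∂ν ≤ C * l * ν {x | β * l ≤ w x})
    {l : ℝ≥0} (hl : ∫⁻ x, (w x : ℝ≥0∞) ∂ν < l) (N : ℕ) :
    (N : ℝ≥0∞) * ∫⁻ x in {x | 2 ^ N * l ≤ w x}, (w x : ℝ≥0∞) ∂ν ≤
      (C / β * 2 : ℝ≥0) * ∫⁻ x in {x | β * l ≤ w x}, (w x : ℝ≥0∞) ∂ν := by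
  have hw' : Measurable fun x => (w x : ℝ≥0∞) := hw.coe_nnreal_ennreal
  have hm (t : ℝ≥0) : MeasurableSet {x | t ≤ w x} := measurableSet_le measurable_const hw
  calc (N : ℝ≥0∞) * ∫⁻ x in {x | 2 ^ N * l ≤ w x}, (w x : ℝ≥0∞) ∂ν
      = ∑ k ∈ Finset.range N, ∫⁻ x in {x | 2 ^ N * l ≤ w x}, (w x : ℝ≥0∞) ∂ν := by simp
    _ ≤ ∑ k ∈ Finset.range N, (C * (2 ^ k * l : ℝ≥0)) * ν {x | β * (2 ^ k * l) ≤ w x} := by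
        refine Finset.sum_le_sum fun k hk => ?_
        refine (lintegral_mono_set ?_).trans (h (2 ^ k * l) (hl.trans_le ?_))
        · intro x hx
          refine le_trans ?_ (show 2 ^ N * l ≤ w x from hx)
          gcongr
          · exact one_le_two
          · exact (Finset.mem_range.1 hk).le
        · exact ENNReal.coe_le_coe.2 (le_mul_of_one_le_left' (one_le_pow₀ one_le_two))
    _ = (C / β : ℝ≥0) * ∑ k ∈ Finset.range N,
          ∫⁻ x, (if (β * l : ℝ≥0∞) * 2 ^ k ≤ w x then (β * l : ℝ≥0∞) * 2 ^ k else 0) ∂ν := by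
        rw [Finset.mul_sum]
        refine Finset.sum_congr rfl fun k _ => ?_
        have e1 : (fun x => if (β * l : ℝ≥0∞) * 2 ^ k ≤ w x then (β * l : ℝ≥0∞) * 2 ^ k else 0) =
            {x | β * (2 ^ k * l) ≤ w x}.indicator fun _ => (β * l : ℝ≥0∞) * 2 ^ k := by
          ext x
          have : ((β * l : ℝ≥0∞) * 2 ^ k ≤ w x) ↔ β * (2 ^ k * l) ≤ w x := by
            rw [show (β * l : ℝ≥0∞) * 2 ^ k = ((β * (2 ^ k * l) : ℝ≥0) : ℝ≥0∞) by push_cast; ring,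
              ENNReal.coe_le_coe]
          by_cases hx : β * (2 ^ k * l) ≤ w x
          · rw [if_pos (this.2 hx), indicator_of_mem (by exact hx)]
          · rw [if_neg (fun h => hx (this.1 h)), indicator_of_notMem (by exact hx)]
        rw [e1, lintegral_indicator_const (hm _), ← mul_assoc]
        have : C * (2 ^ k * l) = C / β * (β * l * 2 ^ k) := by field_simp
        have h2 := congrArg ((↑) : ℝ≥0 → ℝ≥0∞) this
        rw [ENNReal.coe_mul, ENNReal.coe_mul (C / β), ENNReal.coe_mul (β * l), ENNReal.coe_mul β,
          ENNReal.coe_pow, ENNReal.coe_ofNat] at h2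
        rw [h2, mul_assoc]
    _ = (C / β : ℝ≥0) * ∫⁻ x, ∑ k ∈ Finset.range N,
          (if (β * l : ℝ≥0∞) * 2 ^ k ≤ w x then (β * l : ℝ≥0∞) * 2 ^ k else 0) ∂ν := by
        rw [lintegral_finsetSum]
        exact fun k _ => Measurable.ite (measurableSet_le measurable_const hw') measurable_const
          measurable_const
    _ ≤ (C / β : ℝ≥0) * ∫⁻ x, 2 * (if (β * l : ℝ≥0∞) ≤ w x then (w x : ℝ≥0∞) else 0) ∂ν := by
        gcongr with x
        exact sum_indicator_two_pow_le _ _ _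
    _ = _ := by
        rw [lintegral_const_mul' _ _ (by simp), ← mul_assoc, ← lintegral_indicator (hm _)]
        push_cast
        congr 2
        ext x
        by_cases hx : β * l ≤ w x
        · rw [if_pos (by exact_mod_cast hx), indicator_of_mem (by exact hx)]
        · rw [if_neg (by exact_mod_cast hx), indicator_of_notMem (by exact hx)]

/-- `(P8)` implies that `w {w ≥ t}` is at least halved when `t ≥ w_B` is multiplied by a fixed
factor `a`. -/
theorem holds_P3_of_P8 (h𝓑 : IsBasis μ 𝓑) (hw : IsWeight μ 𝓑 w)
    (h : Condition.P8.Holds μ 𝓑 w) : Condition.P3.Holds μ 𝓑 w := by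
  obtain ⟨C, β₀, hC, hβ₀, h⟩ := h
  -- `(P8)` persists for smaller `β`; with `β < 1` every `t ≥ w_B` is `β * l` for some `l > w_B`
  set β : ℝ≥0 := min β₀ (1 / 2) with hβdef
  have hβ : 0 < β := lt_min hβ₀ (by positivity)
  have hβ1 : β < 1 := (min_le_right _ _).trans_lt (by norm_num [div_lt_one])
  obtain ⟨N, hN⟩ := exists_nat_ge (2 * (C / β * 2))
  have hN0 : 0 < (N : ℝ≥0) := lt_of_lt_of_le (by positivity) hN
  set a : ℝ≥0 := 2 ^ N / β with ha
  have ha1 : 1 < a := by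
    rw [ha, one_lt_div hβ]
    exact hβ1.trans_le (one_le_pow₀ one_le_two)
  refine holds_P3_of_geometric_tail h𝓑 hw ha1 (ρ := 1 / 2) (C := 1) (by norm_num [div_lt_one])
    fun B hB k => ?_
  have hW0 := hw.lintegral_cond_ne_zero h𝓑 hB
  have hWt := hw.lintegral_cond_ne_top h𝓑 hB
  have h8 : ∀ l : ℝ≥0, ∫⁻ x, (w x : ℝ≥0∞) ∂(ProbabilityTheory.cond μ B) < l →
      ∫⁻ x in {x | l ≤ w x}, (w x : ℝ≥0∞) ∂(ProbabilityTheory.cond μ B) ≤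
        C * l * ProbabilityTheory.cond μ B {x | β * l ≤ w x} := by
    intro l hl
    have h1 := h B hB l (by rwa [wAvg_eq_lintegral_cond])
    rw [h𝓑.wMeas_eq hB (sep_subset _ _), h𝓑.measure_eq hB (sep_subset _ _),
      h𝓑.setLIntegral_cond_sep hB, h𝓑.cond_sep hB, mul_left_comm,
      ENNReal.mul_le_mul_iff_right (h𝓑.measure_pos B hB).ne' (h𝓑.measure_lt_top B hB).ne] at h1
    refine h1.trans ?_
    gcongr
    exact min_le_left _ _
  set ν := ProbabilityTheory.cond μ B
  set W := ∫⁻ x, (w x : ℝ≥0∞) ∂ν with hWdef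
  have step (t : ℝ≥0) (ht : W ≤ t) : ∫⁻ x in {x | a * t ≤ w x}, (w x : ℝ≥0∞) ∂ν ≤
      ((1 / 2 : ℝ≥0) : ℝ≥0∞) * ∫⁻ x in {x | t ≤ w x}, (w x : ℝ≥0∞) ∂ν := by
    have ht0 : 0 < t := by
      exact ENNReal.coe_pos.1 ((pos_iff_ne_zero.2 hW0).trans_le ht)
    have hl : W < (t / β : ℝ≥0) := ht.trans_lt (by
      rw [ENNReal.coe_lt_coe, lt_div_iff₀ hβ]
      exact mul_lt_of_lt_one_right ht0 hβ1)
    have h1 := nsmul_setLIntegral_le_of_P8 hw.measurable hβ h8 hl N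
    rw [mul_div_cancel₀ _ hβ.ne', show 2 ^ N * (t / β) = a * t by rw [ha]; ring] at h1
    have h2 : ((C / β * 2 : ℝ≥0) : ℝ≥0∞) ≤ (N : ℝ≥0∞) * ((1 / 2 : ℝ≥0) : ℝ≥0∞) := by
      have : C / β * 2 ≤ N * (1 / 2) := by
        rw [mul_one_div, le_div_iff₀ two_pos, mul_comm]
        exact hN
      exact_mod_cast this
    have h3 := h1.trans (mul_le_mul' h2 le_rfl)
    rw [mul_assoc] at h3
    exact (ENNReal.mul_le_mul_iff_right (by exact_mod_cast hN0.ne') (by simp)).1 h3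
  lift W to ℝ≥0 using hWt with W'
  have hset (k : ℕ) : {x | (a : ℝ≥0∞) ^ k ≤ w x / (W' : ℝ≥0∞)} = {x | a ^ k * W' ≤ w x} := by
    ext x
    rw [mem_ofPred_eq, mem_ofPred_eq, ENNReal.le_div_iff_mul_le (Or.inl hW0) (Or.inl (by simp))]
    exact_mod_cast Iff.rfl
  rw [hset]
  clear hset
  induction k with
  | zero =>
    simp only [pow_zero, ENNReal.coe_one, one_mul]
    rw [hWdef]
    exact setLIntegral_le_lintegral _ _
  | succ k ih =>
    have h1 := step (a ^ k * W') (by exact_mod_cast le_mul_of_one_le_left' (one_le_pow₀ ha1.le))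
    rw [← mul_assoc, ← pow_succ'] at h1
    refine h1.trans ((mul_le_mul' le_rfl ih).trans_eq ?_)
    rw [pow_succ]
    ring

theorem holds_P6_of_P3 (h𝓑 : IsBasis μ 𝓑) (hw : IsWeight μ 𝓑 w)
    (h : Condition.P3.Holds μ 𝓑 w) : Condition.P6.Holds μ 𝓑 w := by
  obtain ⟨q, hq, C, hC, h⟩ := h
  have hq0 : 0 < q := by linarith
  have hq1 : 0 < q - 1 := by linarith
  refine ⟨C ^ q * ⟨(q - 1)⁻¹, by positivity⟩, ?_, fun B hB => ?_⟩
  · exact mul_pos (by positivity) (show (0 : ℝ) < (q - 1)⁻¹ by positivity)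
  have hW0 := hw.lintegral_cond_ne_zero h𝓑 hB
  have hWt := hw.lintegral_cond_ne_top h𝓑 hB
  have hμ0 := (h𝓑.measure_pos B hB).ne'
  have hμt := (h𝓑.measure_lt_top B hB).ne
  specialize h B hB
  rw [h𝓑.wMeas_self_eq hB, ← ENNReal.mul_div_cancel (b := ∫⁻ _ in B, _ ∂μ) hμ0 hμt]
  change μ B * avg μ B _ ≤ _
  rw [avg_eq_lintegral_cond, mul_left_comm]
  refine mul_le_mul' le_rfl ?_
  rw [wAvg_eq_lintegral_cond]
  simp only [avg_eq_lintegral_cond] at h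
  set ν := ProbabilityTheory.cond μ B
  set W := ∫⁻ x, (w x : ℝ≥0∞) ∂ν
  have hq' := ENNReal.rpow_le_rpow h hq0.le
  rw [← ENNReal.rpow_mul, one_div_mul_cancel hq0.ne', ENNReal.rpow_one,
    ENNReal.mul_rpow_of_nonneg _ _ hq0.le, ← ENNReal.coe_rpow_of_nonneg _ hq0.le] at hq'
  have hWr : 0 < W.toReal := ENNReal.toReal_pos hW0 hWt
  set c : ℝ≥0 := ⟨(q - 1)⁻¹, by positivity⟩ with hc
  have hcc : ENNReal.ofReal (q - 1)⁻¹ = c := by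
    rw [ENNReal.ofReal, ENNReal.coe_inj]
    exact Real.toNNReal_of_nonneg (by positivity)
  have hpt (x : X) : (w x : ℝ≥0∞) * ENNReal.ofReal (Real.posLog ((w x : ℝ) / W.toReal)) ≤
      c * (W ^ (q - 1))⁻¹ * (w x : ℝ≥0∞) ^ q := by
    have h1 : Real.posLog ((w x : ℝ) / W.toReal) ≤ (q - 1)⁻¹ * ((w x : ℝ) / W.toReal) ^ (q - 1) := by
      refine max_le (by positivity) ?_
      rw [inv_mul_eq_div]
      exact Real.log_le_rpow_div (by positivity) hq1
    have h2 := ENNReal.ofReal_le_ofReal h1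
    rw [ENNReal.ofReal_mul (by positivity), ← ENNReal.ofReal_rpow_of_nonneg (by positivity) hq1.le,
      ENNReal.ofReal_div_of_pos hWr, ENNReal.ofReal_toReal hWt, ENNReal.ofReal_coe_nnreal, hcc,
      ENNReal.div_rpow_of_nonneg _ _ hq1.le] at h2
    refine (mul_le_mul' le_rfl h2).trans_eq ?_
    conv_rhs => rw [show q = 1 + (q - 1) by ring, ENNReal.rpow_add_of_nonneg _ _ zero_le_one hq1.le,
      ENNReal.rpow_one]
    rw [show 1 + (q - 1) - 1 = q - 1 by ring, div_eq_mul_inv]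
    ring
  calc _ ≤ ∫⁻ x, c * (W ^ (q - 1))⁻¹ * (w x : ℝ≥0∞) ^ q ∂ν := lintegral_mono hpt
    _ = c * (W ^ (q - 1))⁻¹ * ∫⁻ x, (w x : ℝ≥0∞) ^ q ∂ν :=
        lintegral_const_mul _ (hw.measurable_coe.pow_const _)
    _ ≤ c * (W ^ (q - 1))⁻¹ * ((C ^ q : ℝ≥0) * W ^ q) := mul_le_mul' le_rfl hq'
    _ = (C ^ q : ℝ≥0) * c * ((W ^ (q - 1))⁻¹ * W ^ q) := by ring
    _ = _ := by
        rw [← ENNReal.rpow_neg, ← ENNReal.rpow_add _ _ hW0 hWt,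
          show -(q - 1) + q = 1 by ring, ENNReal.rpow_one, ENNReal.coe_mul]

theorem holds_P4_of_P6 (h𝓑 : IsBasis μ 𝓑) (hw : IsWeight μ 𝓑 w)
    (h : Condition.P6.Holds μ 𝓑 w) : Condition.P4.Holds μ 𝓑 w := by
  obtain ⟨C, hC, h⟩ := h
  -- above the level `L w_B` the logarithm is at least `4 * C`
  set L : ℝ≥0 := ⟨Real.exp (4 * C), by positivity⟩ with hL
  have hL1 : 1 ≤ L := Real.one_le_exp (by positivity)
  have hL0 : 0 < L := one_pos.trans_le hL1
  refine ⟨1 / (4 * L), 1 / 2, by positivity, ?_, by positivity, by norm_num [div_lt_one],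
    fun B hB E hE hEm hlt => ?_⟩
  · rw [div_lt_one (by positivity)]
    exact lt_of_lt_of_le (by norm_num) (mul_le_mul' (le_refl (4 : ℝ≥0)) hL1)
  have hW0 := hw.lintegral_cond_ne_zero h𝓑 hB
  have hWt := hw.lintegral_cond_ne_top h𝓑 hB
  have hμ0 := (h𝓑.measure_pos B hB).ne'
  have hμt := (h𝓑.measure_lt_top B hB).ne
  specialize h B hB
  rw [h𝓑.wMeas_self_eq hB, ← ENNReal.mul_div_cancel (b := ∫⁻ _ in B, _ ∂μ) hμ0 hμt] at h
  change μ B * avg μ B _ ≤ _ at h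
  rw [avg_eq_lintegral_cond, mul_left_comm, ENNReal.mul_le_mul_iff_right hμ0 hμt,
    wAvg_eq_lintegral_cond] at h
  rw [h𝓑.measure_eq hB hE, mul_comm, ENNReal.mul_lt_mul_iff_left hμ0 hμt] at hlt
  rw [h𝓑.wMeas_eq hB hE, h𝓑.wMeas_self_eq hB, mul_left_comm]
  refine mul_le_mul' le_rfl ?_
  set ν := ProbabilityTheory.cond μ B
  set W := ∫⁻ x, (w x : ℝ≥0∞) ∂ν
  have hWr : 0 < W.toReal := ENNReal.toReal_pos hW0 hWt
  have hm : Measurable fun x => (w x : ℝ≥0∞) *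
      ENNReal.ofReal (Real.posLog ((w x : ℝ) / W.toReal)) :=
    hw.measurable_coe.mul (ENNReal.measurable_ofReal.comp
      ((measurable_const.max Real.measurable_log).comp
        (hw.measurable.coe_nnreal_real.div_const _)))
  have hpt (x : X) : (w x : ℝ≥0∞) ≤ L * W + ((4 * C : ℝ≥0) : ℝ≥0∞)⁻¹ * ((w x : ℝ≥0∞) *
      ENNReal.ofReal (Real.posLog ((w x : ℝ) / W.toReal))) := by
    rcases le_total (w x : ℝ≥0∞) (L * W) with hx | hx
    · exact hx.trans le_self_add
    · refine le_trans ?_ le_add_self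
      have h1 : Real.exp (4 * C) ≤ w x / W.toReal := by
        rw [le_div_iff₀ hWr]
        have := ENNReal.toReal_mono (by simp) hx
        rwa [ENNReal.toReal_mul, ENNReal.coe_toReal, ENNReal.coe_toReal] at this
      have h2 : (4 * C : ℝ) ≤ Real.posLog ((w x : ℝ) / W.toReal) :=
        le_max_of_le_right ((Real.le_log_iff_exp_le ((Real.exp_pos _).trans_le h1)).2 h1)
      have h3 : ((4 * C : ℝ≥0) : ℝ≥0∞) ≤ ENNReal.ofReal (Real.posLog ((w x : ℝ) / W.toReal)) := by
        rw [← ENNReal.ofReal_coe_nnreal]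
        exact ENNReal.ofReal_le_ofReal (by simpa using h2)
      calc (w x : ℝ≥0∞) = ((4 * C : ℝ≥0) : ℝ≥0∞)⁻¹ * (w x * ((4 * C : ℝ≥0) : ℝ≥0∞)) := by
            rw [mul_left_comm, ENNReal.inv_mul_cancel (by positivity) ENNReal.coe_ne_top, mul_one]
        _ ≤ _ := by gcongr
  calc ∫⁻ x in E, (w x : ℝ≥0∞) ∂ν ≤ ∫⁻ x in E, (L * W + ((4 * C : ℝ≥0) : ℝ≥0∞)⁻¹ * ((w x : ℝ≥0∞) *
      ENNReal.ofReal (Real.posLog ((w x : ℝ) / W.toReal)))) ∂ν := lintegral_mono hpt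
    _ = L * W * ν E + ((4 * C : ℝ≥0) : ℝ≥0∞)⁻¹ * ∫⁻ x in E, ((w x : ℝ≥0∞) *
      ENNReal.ofReal (Real.posLog ((w x : ℝ) / W.toReal))) ∂ν := by
        rw [lintegral_add_left measurable_const, setLIntegral_const, lintegral_const_mul _ hm]
    _ ≤ L * W * ((1 / (4 * L) : ℝ≥0) : ℝ≥0∞) + ((4 * C : ℝ≥0) : ℝ≥0∞)⁻¹ * (C * W) := by
        gcongr
        exact (setLIntegral_le_lintegral _ _).trans h
    _ = ((L * (1 / (4 * L)) + (4 * C)⁻¹ * C : ℝ≥0) : ℝ≥0∞) * W := by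
        rw [ENNReal.coe_add, ENNReal.coe_mul L, ENNReal.coe_mul (4 * C)⁻¹,
          ENNReal.coe_inv (show 4 * C ≠ 0 by positivity)]
        ring
    _ = _ := by
        congr 2
        rw [← NNReal.coe_inj]
        push_cast
        field_simp
        norm_num

theorem holds_P4_of_P4' (h𝓑 : IsBasis μ 𝓑) (hw : IsWeight μ 𝓑 w)
    (h : Condition.P4'.Holds μ 𝓑 w) : Condition.P4.Holds μ 𝓑 w := by
  obtain ⟨α, β, hα, hα1, hβ, hβ1, h⟩ := h
  set α' : ℝ≥0 := (1 - β) / 2 with hα'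
  have hβ' : 0 < 1 - β := tsub_pos_of_lt hβ1
  have hγ : 0 < α * α' := by positivity
  have hα'1 : α' < 1 := by
    rw [hα', div_lt_one two_pos]
    exact tsub_le_self.trans_lt one_lt_two
  have hγ1 : α * α' < 1 := mul_lt_one_of_lt_of_le hα1 hα'1.le
  refine ⟨α', 1 - α * α', by positivity, hα'1, tsub_pos_of_lt hγ1, tsub_lt_self one_pos hγ,
    fun B hB E hE hEm hlt => ?_⟩
  have hWt := hw.lintegral_cond_ne_top h𝓑 hB
  have hμ0 := (h𝓑.measure_pos B hB).ne'
  have hμt := (h𝓑.measure_lt_top B hB).ne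
  have := h𝓑.isProbabilityMeasure_cond hB
  specialize h B hB
  rw [h𝓑.measure_eq hB (sep_subset _ _), mul_comm, ENNReal.mul_le_mul_iff_left hμ0 hμt,
    h𝓑.cond_sep hB, wAvg_eq_lintegral_cond] at h
  rw [h𝓑.measure_eq hB hE, mul_comm, ENNReal.mul_lt_mul_iff_left hμ0 hμt] at hlt
  rw [h𝓑.wMeas_eq hB hE, h𝓑.wMeas_self_eq hB, mul_left_comm]
  refine mul_le_mul' le_rfl ?_
  set ν := ProbabilityTheory.cond μ B
  set W := ∫⁻ x, (w x : ℝ≥0∞) ∂ν with hWdef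
  have hFm : MeasurableSet {x | (w x : ℝ≥0∞) ≤ α * W} :=
    measurableSet_le hw.measurable_coe measurable_const
  set G := (E ∪ {x | (w x : ℝ≥0∞) ≤ α * W})ᶜ with hG
  have hGm : MeasurableSet G := (hEm.union hFm).compl
  have hG1 : (α' : ℝ≥0∞) ≤ ν G := by
    rw [hG, prob_compl_eq_one_sub (hEm.union hFm)]
    refine ENNReal.le_sub_of_add_le_left (measure_ne_top _ _) ?_
    calc _ ≤ ((α' : ℝ≥0∞) + β) + α' := by
          gcongr
          exact (measure_union_le _ _).trans (add_le_add hlt.le h)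
      _ = ((α' + β + α' : ℝ≥0) : ℝ≥0∞) := by push_cast; rfl
      _ = 1 := by
          rw [ENNReal.coe_eq_one, ← NNReal.coe_inj, hα']
          push_cast [hβ1.le]
          ring
  have hG2 : ((α * α' : ℝ≥0) : ℝ≥0∞) * W ≤ ∫⁻ x in Eᶜ, (w x : ℝ≥0∞) ∂ν := by
    calc _ = α * W * (α' : ℝ≥0∞) := by push_cast; ring
      _ ≤ α * W * ν G := by gcongr
      _ = ∫⁻ x in G, α * W ∂ν := (setLIntegral_const _ _).symm
      _ ≤ ∫⁻ x in G, (w x : ℝ≥0∞) ∂ν :=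
          setLIntegral_mono' hGm fun x hx => (not_le.1 fun h => hx (Or.inr h)).le
      _ ≤ _ := lintegral_mono_set fun x hx h => hx (Or.inl h)
  have hsplit := lintegral_add_compl (μ := ν) (fun x => (w x : ℝ≥0∞)) hEm
  rw [ENNReal.coe_sub, ENNReal.sub_mul (fun _ _ => hWt), ENNReal.coe_one, one_mul]
  refine ENNReal.le_sub_of_add_le_right (ENNReal.mul_ne_top ENNReal.coe_ne_top hWt) ?_
  exact (add_le_add le_rfl hG2).trans_eq hsplit

theorem holds_P4'_of_P4 (h𝓑 : IsBasis μ 𝓑) (hw : IsWeight μ 𝓑 w)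
    (h : Condition.P4.Holds μ 𝓑 w) : Condition.P4'.Holds μ 𝓑 w := by
  obtain ⟨α, β, hα, hα1, hβ, hβ1, h⟩ := h
  have hβ' : 0 < 1 - β := tsub_pos_of_lt hβ1
  refine ⟨(1 - β) / 2, 1 - α, by positivity, ?_, tsub_pos_of_lt hα1, tsub_lt_self one_pos hα,
    fun B hB => ?_⟩
  · rw [div_lt_one two_pos]
    exact tsub_le_self.trans_lt one_lt_two
  have hW0 := hw.lintegral_cond_ne_zero h𝓑 hB
  have hWt := hw.lintegral_cond_ne_top h𝓑 hB
  have hμ0 := (h𝓑.measure_pos B hB).ne'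
  have hμt := (h𝓑.measure_lt_top B hB).ne
  have := h𝓑.isProbabilityMeasure_cond hB
  have hFm : MeasurableSet {x | (w x : ℝ≥0∞) ≤ ((1 - β) / 2 : ℝ≥0) * wAvg μ w B} :=
    measurableSet_le hw.measurable_coe measurable_const
  by_contra! hlt
  rw [h𝓑.measure_eq hB (sep_subset _ _), mul_comm, ENNReal.mul_lt_mul_iff_right hμ0 hμt,
    h𝓑.cond_sep hB] at hlt
  have h1 := h B hB {x ∈ B | ¬ (w x : ℝ≥0∞) ≤ ((1 - β) / 2 : ℝ≥0) * wAvg μ w B} (sep_subset _ _)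
    ((h𝓑.measurableSet B hB).inter hFm.compl) (by
      rw [h𝓑.measure_eq hB (sep_subset _ _), mul_comm, ENNReal.mul_lt_mul_iff_left hμ0 hμt,
        h𝓑.cond_sep hB]
      change ProbabilityTheory.cond μ B {x | (w x : ℝ≥0∞) ≤ ((1 - β) / 2 : ℝ≥0) * wAvg μ w B}ᶜ < _
      rw [prob_compl_eq_one_sub hFm]
      refine ENNReal.sub_lt_of_lt_add prob_le_one ?_
      calc (1 : ℝ≥0∞) = α + (1 - α : ℝ≥0) := by
            rw [← ENNReal.coe_add, add_tsub_cancel_of_le hα1.le, ENNReal.coe_one]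
        _ < _ := (ENNReal.add_lt_add_iff_left (by simp)).2 hlt)
  rw [h𝓑.wMeas_eq hB (sep_subset _ _), h𝓑.wMeas_self_eq hB, mul_left_comm,
    ENNReal.mul_le_mul_iff_right hμ0 hμt, h𝓑.setLIntegral_cond_sep hB] at h1
  rw [wAvg_eq_lintegral_cond] at h1 hFm
  set ν := ProbabilityTheory.cond μ B
  set W := ∫⁻ x, (w x : ℝ≥0∞) ∂ν with hWdef
  have hsplit := lintegral_add_compl (μ := ν) (fun x => (w x : ℝ≥0∞)) hFm
  have h2 : ∫⁻ x in {x | (w x : ℝ≥0∞) ≤ ((1 - β) / 2 : ℝ≥0) * W}, (w x : ℝ≥0∞) ∂ν ≤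
      ((1 - β) / 2 : ℝ≥0) * W := by
    refine (setLIntegral_mono' hFm fun x hx => hx).trans ?_
    rw [setLIntegral_const]
    exact mul_le_of_le_one_right' prob_le_one
  have h3 : W ≤ (((1 - β) / 2 + β : ℝ≥0) : ℝ≥0∞) * W := by
    rw [ENNReal.coe_add, add_mul]
    exact hsplit.symm.trans_le (add_le_add h2 h1)
  have h4 : (((1 - β) / 2 + β : ℝ≥0) : ℝ≥0∞) < 1 := by
    rw [ENNReal.coe_lt_one_iff, ← NNReal.coe_lt_coe]
    push_cast [hβ1.le]
    have : (β : ℝ) < 1 := hβ1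
    linarith
  have h5 := ENNReal.mul_lt_mul_left hW0 hWt h4
  rw [one_mul] at h5
  exact absurd h3 (not_le.2 h5)

theorem IsBasis.median_eq (h𝓑 : IsBasis μ 𝓑) {B : Set X} (hB : B ∈ 𝓑) :
    median μ w B = sInf {t : ℝ≥0∞ | ProbabilityTheory.cond μ B {x | t < (w x : ℝ≥0∞)} < 1 / 2} := by
  rw [median]
  congr 1
  ext t
  rw [mem_ofPred_eq, mem_ofPred_eq, h𝓑.measure_eq hB (sep_subset _ _), h𝓑.cond_sep hB,
    ← mul_one_div, ENNReal.mul_lt_mul_iff_right (h𝓑.measure_pos B hB).ne' (h𝓑.measure_lt_top B hB).ne]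

theorem holds_P4_of_P5 (h𝓑 : IsBasis μ 𝓑) (hw : IsWeight μ 𝓑 w)
    (h : Condition.P5.Holds μ 𝓑 w) : Condition.P4.Holds μ 𝓑 w := by
  refine holds_P4_of_P4' h𝓑 hw ?_
  obtain ⟨C, hC, h⟩ := h
  refine ⟨1 / (C + 1), 1 / 2, by positivity, ?_, by positivity, by norm_num [div_lt_one],
    fun B hB => ?_⟩
  · rw [div_lt_one (by positivity)]
    exact lt_add_of_pos_left _ hC
  have hW0 := hw.lintegral_cond_ne_zero h𝓑 hB
  have hWt := hw.lintegral_cond_ne_top h𝓑 hB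
  have hμ0 := (h𝓑.measure_pos B hB).ne'
  have hμt := (h𝓑.measure_lt_top B hB).ne
  have := h𝓑.isProbabilityMeasure_cond hB
  specialize h B hB
  have hFm : MeasurableSet {x | (w x : ℝ≥0∞) ≤ (1 / (C + 1) : ℝ≥0) * wAvg μ w B} :=
    measurableSet_le hw.measurable_coe measurable_const
  rw [h𝓑.measure_eq hB (sep_subset _ _), mul_comm, ENNReal.mul_le_mul_iff_left hμ0 hμt,
    h𝓑.cond_sep hB]
  rw [wAvg_eq_lintegral_cond] at h hFm ⊢
  rw [h𝓑.median_eq hB] at h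
  set ν := ProbabilityTheory.cond μ B
  set W := ∫⁻ x, (w x : ℝ≥0∞) ∂ν with hWdef
  have h1 : ¬ ν {x | ((1 / (C + 1) : ℝ≥0) : ℝ≥0∞) * W < w x} < 1 / 2 := by
    intro hlt
    have h2 := h.trans (mul_le_mul' le_rfl (sInf_le hlt))
    rw [← mul_assoc, ← ENNReal.coe_mul] at h2
    have h3 : ((C * (1 / (C + 1)) : ℝ≥0) : ℝ≥0∞) < 1 := by
      rw [ENNReal.coe_lt_one_iff, mul_one_div, div_lt_one (by positivity)]
      exact lt_add_one C
    have h5 := ENNReal.mul_lt_mul_left hW0 hWt h3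
    rw [one_mul] at h5
    exact absurd h2 (not_le.2 h5)
  have h2 := prob_add_prob_compl (μ := ν) hFm
  have h3 : {x | (w x : ℝ≥0∞) ≤ (1 / (C + 1) : ℝ≥0) * W}ᶜ =
      {x | ((1 / (C + 1) : ℝ≥0) : ℝ≥0∞) * W < w x} := by
    ext x; simp
  rw [h3] at h2
  rw [ENNReal.eq_sub_of_add_eq (measure_ne_top _ _) h2]
  refine (tsub_le_tsub_left (not_lt.1 h1) 1).trans_eq ?_
  simp

theorem exists_rpow_mul_half_rpow_le (C : ℝ≥0) :
    ∃ s : ℝ, 0 < s ∧ s < 1 ∧ C ^ s * (1 / 2) ^ (1 - s) ≤ 3 / 4 := by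
  obtain ⟨s, hs, hs1, h⟩ := exists_rpow_mul_lt_one (a := 2 * C + 2) (ρ := 2 / 3)
    (by exact one_lt_two.trans_le le_add_self) (by norm_num [div_lt_one])
  refine ⟨s, hs, hs1, ?_⟩
  have e : (1 / 2 : ℝ≥0) ^ (1 - s) = 1 / 2 * 2 ^ s := by
    rw [NNReal.rpow_sub (by norm_num), NNReal.rpow_one, one_div 2, NNReal.inv_rpow, div_inv_eq_mul]
  rw [e, mul_left_comm, ← NNReal.mul_rpow]
  have h1 : (C * 2) ^ s ≤ (2 * C + 2) ^ s := NNReal.rpow_le_rpow (by rw [mul_comm]; exact le_self_add) hs.le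
  have h2 : (C * 2) ^ s * (2 / 3) ≤ 1 := (mul_le_mul' h1 le_rfl).trans h.le
  rw [← NNReal.coe_le_coe] at h2 ⊢
  push_cast at h2 ⊢
  linarith

/-- Where `w ≤ t`, `w ^ s` is at most `t ^ s`; if `{w > t}` has less than half of the mass, Hölder's
inequality bounds the remaining part of the integral of `w ^ s` by a fraction of `w_B ^ s`, and for
`s` close to `0` the constant `C ^ s` cannot compensate that fraction. -/
theorem holds_P5_of_P2' (h𝓑 : IsBasis μ 𝓑) (hw : IsWeight μ 𝓑 w)
    (h : Condition.P2'.Holds μ 𝓑 w) : Condition.P5.Holds μ 𝓑 w := by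
  obtain ⟨C, hC, h⟩ := h
  obtain ⟨s, hs, hs1, hCs⟩ := exists_rpow_mul_half_rpow_le C
  refine ⟨4 ^ (1 / s) * C, by positivity, fun B hB => ?_⟩
  have hW0 := hw.lintegral_cond_ne_zero h𝓑 hB
  have hWt := hw.lintegral_cond_ne_top h𝓑 hB
  have := h𝓑.isProbabilityMeasure_cond hB
  specialize h s hs hs1 B hB
  rw [h𝓑.median_eq hB, wAvg_eq_lintegral_cond]
  simp only [avg_eq_lintegral_cond] at h
  set ν := ProbabilityTheory.cond μ B
  set W := ∫⁻ x, (w x : ℝ≥0∞) ∂ν with hWdef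
  have hK0 : ((4 ^ (1 / s) * C : ℝ≥0) : ℝ≥0∞) ≠ 0 := by
    rw [ENNReal.coe_ne_zero]; positivity
  rw [← ENNReal.div_le_iff' hK0 ENNReal.coe_ne_top]
  refine le_sInf fun t ht => ?_
  rw [ENNReal.div_le_iff' hK0 ENNReal.coe_ne_top]
  have hFm : MeasurableSet {x | t < (w x : ℝ≥0∞)} :=
    measurableSet_lt measurable_const hw.measurable_coe
  have hhol : ∫⁻ x in {x | t < (w x : ℝ≥0∞)}, (w x : ℝ≥0∞) ^ s ∂ν ≤ W ^ s * (1 / 2) ^ (1 - s) := by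
    have h1 := ENNReal.lintegral_mul_norm_pow_le (μ := ν) (f := fun x => (w x : ℝ≥0∞))
      (g := {x | t < (w x : ℝ≥0∞)}.indicator 1) hw.measurable_coe.aemeasurable
      (measurable_one.indicator hFm).aemeasurable hs.le (sub_nonneg.2 hs1.le) (add_sub_cancel s 1)
    rw [lintegral_indicator_one hFm] at h1
    rw [← lintegral_indicator hFm]
    refine le_trans (lintegral_mono fun x => ?_) (h1.trans ?_)
    · by_cases hx : t < (w x : ℝ≥0∞)
      · rw [indicator_of_mem (by exact hx), indicator_of_mem (by exact hx)]
        simp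
      · rw [indicator_of_notMem (by exact hx)]
        exact zero_le
    · gcongr
      exact ht.le
  have hs' : ∫⁻ x, (w x : ℝ≥0∞) ^ s ∂ν ≤ t ^ s + W ^ s * (1 / 2) ^ (1 - s) := by
    rw [← lintegral_add_compl _ hFm, add_comm]
    refine add_le_add ?_ hhol
    refine (setLIntegral_mono' hFm.compl (g := fun _ => t ^ s) fun x hx =>
      ENNReal.rpow_le_rpow (not_lt.1 hx) hs.le).trans ?_
    rw [setLIntegral_const]
    exact mul_le_of_le_one_right' prob_le_one
  have hWs : W ^ s ≤ C ^ s * t ^ s + ((3 / 4 : ℝ≥0) : ℝ≥0∞) * W ^ s := by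
    have h1 := ENNReal.rpow_le_rpow h hs.le
    rw [ENNReal.mul_rpow_of_nonneg _ _ hs.le, ← ENNReal.rpow_mul, one_div_mul_cancel hs.ne',
      ENNReal.rpow_one] at h1
    refine h1.trans ((mul_le_mul' le_rfl hs').trans ?_)
    rw [mul_add, mul_left_comm, mul_comm _ (W ^ s)]
    gcongr
    have h2 : ((C ^ s * (1 / 2) ^ (1 - s) : ℝ≥0) : ℝ≥0∞) ≤ (3 / 4 : ℝ≥0) := by exact_mod_cast hCs
    rw [ENNReal.coe_mul, ENNReal.coe_rpow_of_nonneg _ hs.le,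
      ENNReal.coe_rpow_of_nonneg _ (sub_nonneg.2 hs1.le)] at h2
    simpa using h2
  have hWst : W ^ s ≠ ∞ := ENNReal.rpow_ne_top_of_nonneg hs.le hWt
  have hquarter : W ^ s ≤ 4 * (C ^ s * t ^ s) := by
    have e : W ^ s = ((1 / 4 : ℝ≥0) : ℝ≥0∞) * W ^ s + ((3 / 4 : ℝ≥0) : ℝ≥0∞) * W ^ s := by
      rw [← add_mul, ← ENNReal.coe_add, show (1 / 4 + 3 / 4 : ℝ≥0) = 1 by
        rw [← NNReal.coe_inj]; push_cast; norm_num, ENNReal.coe_one, one_mul]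
    have h3 : ((1 / 4 : ℝ≥0) : ℝ≥0∞) * W ^ s ≤ C ^ s * t ^ s := by
      have := e.symm.trans_le hWs
      exact (ENNReal.add_le_add_iff_right (ENNReal.mul_ne_top ENNReal.coe_ne_top hWst)).1 this
    calc W ^ s = 4 * (((1 / 4 : ℝ≥0) : ℝ≥0∞) * W ^ s) := by
          rw [← mul_assoc, show (4 : ℝ≥0∞) = ((4 : ℝ≥0) : ℝ≥0∞) from rfl, ← ENNReal.coe_mul,
            show (4 * (1 / 4) : ℝ≥0) = 1 by rw [← NNReal.coe_inj]; push_cast; norm_num,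
            ENNReal.coe_one, one_mul]
      _ ≤ _ := by gcongr
  have h1 := ENNReal.rpow_le_rpow hquarter (show 0 ≤ 1 / s by positivity)
  rwa [← ENNReal.mul_rpow_of_nonneg _ _ hs.le, ENNReal.mul_rpow_of_nonneg _ _ (by positivity),
    ← ENNReal.rpow_mul, ← ENNReal.rpow_mul, mul_one_div_cancel hs.ne', ENNReal.rpow_one,
    ENNReal.rpow_one, ← mul_assoc, show (4 : ℝ≥0∞) = ((4 : ℝ≥0) : ℝ≥0∞) from rfl,
    ← ENNReal.coe_rpow_of_nonneg _ (by positivity), ← ENNReal.coe_mul] at h1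

end Implications

/-! ### Geometric mean and power means -/

section GeometricMean

variable {X : Type*} [MeasurableSpace X] {μ : Measure X} {𝓑 : Set (Set X)} {w : X → ℝ≥0}
  {B : Set X}

theorem toENNReal_log_coe (a : ℝ≥0) :
    (ENNReal.log (a : ℝ≥0∞)).toENNReal = ENNReal.ofReal (Real.log a) := by
  rcases eq_or_ne a 0 with rfl | ha
  · simp
  · rw [ENNReal.log_of_nnreal ha, EReal.real_coe_toENNReal]

theorem toENNReal_neg_log_coe {a : ℝ≥0} (ha : a ≠ 0) :
    (-ENNReal.log (a : ℝ≥0∞)).toENNReal = ENNReal.ofReal (-Real.log a) := by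
  rw [ENNReal.log_of_nnreal ha, ← EReal.coe_neg, EReal.real_coe_toENNReal]

theorem IsBasis.setLIntegral_eq (h𝓑 : IsBasis μ 𝓑) (hB : B ∈ 𝓑) (f : X → ℝ≥0∞) :
    ∫⁻ x in B, f x ∂μ = μ B * ∫⁻ x, f x ∂(ProbabilityTheory.cond μ B) := by
  rw [← avg_eq_lintegral_cond, avg,
    ENNReal.mul_div_cancel (h𝓑.measure_pos B hB).ne' (h𝓑.measure_lt_top B hB).ne]

theorem geomMean_eq_ofReal_exp (h𝓑 : IsBasis μ 𝓑) (hB : B ∈ 𝓑)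
    (hpos : ∀ᵐ x ∂(ProbabilityTheory.cond μ B), w x ≠ 0)
    (hint : Integrable (fun x => Real.log (w x)) (ProbabilityTheory.cond μ B)) :
    geomMean μ w B =
      ENNReal.ofReal (Real.exp (∫ x, Real.log (w x) ∂(ProbabilityTheory.cond μ B))) := by
  have hμt := (h𝓑.measure_lt_top B hB).ne
  have hμr : (μ B).toReal ≠ 0 := (ENNReal.toReal_pos (h𝓑.measure_pos B hB).ne' hμt).ne'
  rw [geomMean, extIntegral, h𝓑.setLIntegral_eq hB, h𝓑.setLIntegral_eq hB]
  simp_rw [toENNReal_log_coe]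
  rw [integral_eq_lintegral_pos_part_sub_lintegral_neg_part hint,
    show ∫⁻ x, (-ENNReal.log (w x : ℝ≥0∞)).toENNReal ∂(ProbabilityTheory.cond μ B) =
      ∫⁻ x, ENNReal.ofReal (-Real.log (w x)) ∂(ProbabilityTheory.cond μ B) from
      lintegral_congr_ae (hpos.mono fun x hx => toENNReal_neg_log_coe hx)]
  have hP : ∫⁻ x, ENNReal.ofReal (Real.log (w x)) ∂(ProbabilityTheory.cond μ B) ≠ ∞ :=
    hint.lintegral_lt_top.ne
  have hN : ∫⁻ x, ENNReal.ofReal (-Real.log (w x)) ∂(ProbabilityTheory.cond μ B) ≠ ∞ :=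
    hint.neg.lintegral_lt_top.ne
  generalize ∫⁻ x, ENNReal.ofReal (Real.log (w x)) ∂(ProbabilityTheory.cond μ B) = P at hP
  generalize ∫⁻ x, ENNReal.ofReal (-Real.log (w x)) ∂(ProbabilityTheory.cond μ B) = N at hN
  rw [← EReal.exp_coe, ← EReal.coe_ennreal_toReal (ENNReal.mul_ne_top hμt hP),
    ← EReal.coe_ennreal_toReal (ENNReal.mul_ne_top hμt hN), ← EReal.coe_ennreal_toReal hμt,
    ← EReal.coe_sub, ← EReal.coe_div, ENNReal.toReal_mul, ENNReal.toReal_mul, ← mul_sub,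
    mul_div_cancel_left₀ _ hμr]

/-- A positive geometric mean forces `w > 0` almost everywhere and `log w` integrable, as the
positive part of `log w` is at most `w`. -/
theorem integrable_log_of_geomMean_ne_zero (h𝓑 : IsBasis μ 𝓑) (hw : IsWeight μ 𝓑 w) (hB : B ∈ 𝓑)
    (h : geomMean μ w B ≠ 0) :
    (∀ᵐ x ∂(ProbabilityTheory.cond μ B), w x ≠ 0) ∧
      Integrable (fun x => Real.log (w x)) (ProbabilityTheory.cond μ B) := by
  have hμ0 := h𝓑.measure_pos B hB
  have hμt := (h𝓑.measure_lt_top B hB).ne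
  rw [geomMean, extIntegral, h𝓑.setLIntegral_eq hB, h𝓑.setLIntegral_eq hB] at h
  simp_rw [toENNReal_log_coe] at h
  have hm : Measurable fun x => (-ENNReal.log (w x : ℝ≥0∞)).toENNReal :=
    measurable_ereal_toENNReal.comp hw.measurable_coe.ennreal_log.neg
  have hP : ∫⁻ x, ENNReal.ofReal (Real.log (w x)) ∂(ProbabilityTheory.cond μ B) ≠ ∞ := by
    refine ne_top_of_le_ne_top (hw.lintegral_cond_ne_top h𝓑 hB) (lintegral_mono fun x => ?_)
    rw [← ENNReal.ofReal_coe_nnreal]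
    exact ENNReal.ofReal_le_ofReal (Real.log_le_self (w x).coe_nonneg)
  have hN : ∫⁻ x, (-ENNReal.log (w x : ℝ≥0∞)).toENNReal ∂(ProbabilityTheory.cond μ B) ≠ ∞ := by
    intro htop
    apply h
    rw [htop, ENNReal.mul_top hμ0.ne', EReal.coe_ennreal_top,
      ← EReal.coe_ennreal_toReal (ENNReal.mul_ne_top hμt hP), EReal.sub_top,
      EReal.bot_div_of_pos_ne_top (by exact_mod_cast hμ0) (by simpa using hμt), EReal.exp_bot]
  have hpos : ∀ᵐ x ∂(ProbabilityTheory.cond μ B), w x ≠ 0 := by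
    filter_upwards [ae_lt_top hm hN] with x hx h0
    simp [h0] at hx
  refine ⟨hpos, (Real.measurable_log.comp hw.measurable.coe_nnreal_real).aestronglyMeasurable, ?_⟩
  have hN' : ∫⁻ x, ENNReal.ofReal (-Real.log (w x)) ∂(ProbabilityTheory.cond μ B) ≠ ∞ := by
    rwa [← lintegral_congr_ae (hpos.mono fun x hx => toENNReal_neg_log_coe hx)]
  have hle : ∫⁻ x, ‖Real.log (w x)‖ₑ ∂(ProbabilityTheory.cond μ B) ≤
      ∫⁻ x, ENNReal.ofReal (Real.log (w x)) ∂(ProbabilityTheory.cond μ B) +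
      ∫⁻ x, ENNReal.ofReal (-Real.log (w x)) ∂(ProbabilityTheory.cond μ B) := by
    have hm' : Measurable fun x => ENNReal.ofReal (Real.log (w x)) :=
      ENNReal.measurable_ofReal.comp (Real.measurable_log.comp hw.measurable.coe_nnreal_real)
    rw [← lintegral_add_left hm']
    refine lintegral_mono fun x => ?_
    rw [Real.enorm_eq_ofReal_abs]
    rcases abs_cases (Real.log (w x)) with ⟨h, -⟩ | ⟨h, -⟩ <;> rw [h]
    · exact le_self_add
    · exact le_add_self
  exact hle.trans_lt (ENNReal.add_lt_top.2 ⟨hP.lt_top, hN'.lt_top⟩)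

theorem integrable_coe_of_lintegral_ne_top {ν : Measure X} (hw : Measurable w)
    (h : ∫⁻ x, (w x : ℝ≥0∞) ∂ν ≠ ∞) : Integrable (fun x => (w x : ℝ)) ν := by
  refine ⟨hw.coe_nnreal_real.aestronglyMeasurable, ?_⟩
  simpa [HasFiniteIntegral] using h.lt_top

theorem rpow_le_one_add {a s : ℝ} (ha : 0 ≤ a) (hs : 0 ≤ s) (hs1 : s ≤ 1) : a ^ s ≤ 1 + a := by
  rcases le_total a 1 with h | h
  · exact (Real.rpow_le_one ha h hs).trans (by linarith)
  · exact (Real.rpow_le_rpow_of_exponent_le h hs1).trans (by rw [Real.rpow_one]; linarith)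

theorem integrable_rpow_coe {ν : Measure X} [IsProbabilityMeasure ν] (hw : Measurable w)
    (h : ∫⁻ x, (w x : ℝ≥0∞) ∂ν ≠ ∞) {s : ℝ} (hs : 0 ≤ s) (hs1 : s ≤ 1) :
    Integrable (fun x => (w x : ℝ) ^ s) ν := by
  refine ((integrable_const (1 : ℝ)).add (integrable_coe_of_lintegral_ne_top hw h)).mono'
    (hw.coe_nnreal_real.pow_const s).aestronglyMeasurable (ae_of_all _ fun x => ?_)
  rw [Real.norm_of_nonneg (by positivity)]
  exact rpow_le_one_add (w x).coe_nonneg hs hs1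

theorem lintegral_rpow_eq_ofReal {ν : Measure X} [IsProbabilityMeasure ν] (hw : Measurable w)
    (h : ∫⁻ x, (w x : ℝ≥0∞) ∂ν ≠ ∞) {s : ℝ} (hs : 0 ≤ s) (hs1 : s ≤ 1) :
    ∫⁻ x, (w x : ℝ≥0∞) ^ s ∂ν = ENNReal.ofReal (∫ x, (w x : ℝ) ^ s ∂ν) := by
  rw [ofReal_integral_eq_lintegral_ofReal (integrable_rpow_coe hw h hs hs1)
    (ae_of_all _ fun x => by positivity)]
  refine lintegral_congr fun x => ?_
  rw [← ENNReal.ofReal_rpow_of_nonneg (w x).coe_nonneg hs, ENNReal.ofReal_coe_nnreal]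

/-- Jensen's inequality: the geometric mean is at most every power mean. -/
theorem holds_P2'_of_P2 (h𝓑 : IsBasis μ 𝓑) (hw : IsWeight μ 𝓑 w)
    (h : Condition.P2.Holds μ 𝓑 w) : Condition.P2'.Holds μ 𝓑 w := by
  obtain ⟨C, hC, h⟩ := h
  refine ⟨C, hC, fun s hs hs1 B hB => (h B hB).trans (mul_le_mul' le_rfl ?_)⟩
  specialize h B hB
  have := h𝓑.isProbabilityMeasure_cond hB
  have hWt := hw.lintegral_cond_ne_top h𝓑 hB
  have hG : geomMean μ w B ≠ 0 := by
    intro h0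
    rw [h0, mul_zero, avg_eq_lintegral_cond] at h
    exact hw.lintegral_cond_ne_zero h𝓑 hB (le_zero_iff.1 h)
  obtain ⟨hpos, hint⟩ := integrable_log_of_geomMean_ne_zero h𝓑 hw hB hG
  rw [geomMean_eq_ofReal_exp h𝓑 hB hpos hint, avg_eq_lintegral_cond,
    lintegral_rpow_eq_ofReal hw.measurable hWt hs.le hs1.le,
    ENNReal.ofReal_rpow_of_nonneg (integral_nonneg fun x => by positivity) (by positivity)]
  apply ENNReal.ofReal_le_ofReal
  set ν := ProbabilityTheory.cond μ B
  have hexp : (fun x => Real.exp (s * Real.log (w x))) =ᵐ[ν] fun x => (w x : ℝ) ^ s := by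
    filter_upwards [hpos] with x hx
    rw [Real.rpow_def_of_pos (by exact_mod_cast pos_iff_ne_zero.2 hx), mul_comm]
  have hJ := convexOn_exp.map_integral_le (μ := ν) (f := fun x => s * Real.log (w x))
    Real.continuous_exp.continuousOn isClosed_univ (ae_of_all _ fun _ => mem_univ _)
    (hint.const_mul s) ((integrable_rpow_coe hw.measurable hWt hs.le hs1.le).congr hexp.symm)
  rw [integral_const_mul, integral_congr_ae hexp] at hJ
  have h1 := Real.rpow_le_rpow (Real.exp_pos _).le hJ (show 0 ≤ 1 / s by positivity)
  rwa [← Real.exp_mul, mul_comm, ← mul_assoc, one_div_mul_cancel hs.ne', one_mul] at h1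

theorem rpow_sub_one_div_le {a s : ℝ} (ha : 0 ≤ a) (hs : 0 < s) (hs1 : s ≤ 1) :
    (a ^ s - 1) / s ≤ a - 1 := by
  rw [div_le_iff₀ hs]
  have := rpow_one_add_le_one_add_mul_self (s := a - 1) (by linarith) hs.le hs1
  rw [add_sub_cancel] at this
  linarith

theorem tendsto_rpow_sub_one_div {a : ℝ} (ha : 0 < a) {u : ℕ → ℝ} (hu : ∀ n, 0 < u n)
    (hu0 : Filter.Tendsto u Filter.atTop (nhds 0)) :
    Filter.Tendsto (fun n => (a ^ u n - 1) / u n) Filter.atTop (nhds (Real.log a)) := by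
  have h1 := (Real.hasStrictDerivAt_const_rpow ha 0).hasDerivAt.tendsto_slope_zero
  have h2 := h1.comp (tendsto_nhdsWithin_iff.2
    ⟨hu0, Filter.Eventually.of_forall fun n => (hu n).ne'⟩)
  simpa [Function.comp_def, div_eq_inv_mul] using h2

/-- Since `(w ^ s - 1) / s` decreases to `log w` as `s` decreases to `0`, Fatou's lemma applied to
`(w - 1) - (w ^ s - 1) / s ≥ 0` turns the bounds of `(P2')` into a lower bound of `∫ log w`. -/
theorem holds_P2_of_P2' (h𝓑 : IsBasis μ 𝓑) (hw : IsWeight μ 𝓑 w)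
    (h : Condition.P2'.Holds μ 𝓑 w) : Condition.P2.Holds μ 𝓑 w := by
  obtain ⟨C, hC, h⟩ := h
  refine ⟨C, hC, fun B hB => ?_⟩
  have := h𝓑.isProbabilityMeasure_cond hB
  have hWt := hw.lintegral_cond_ne_top h𝓑 hB
  have hW0 := hw.lintegral_cond_ne_zero h𝓑 hB
  have h' := fun s hs hs1 => h s hs hs1 B hB
  simp only [avg_eq_lintegral_cond] at h' ⊢
  have hG := geomMean_eq_ofReal_exp (w := w) h𝓑 hB
  have hwi := integrable_coe_of_lintegral_ne_top hw.measurable hWt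
  set ν := ProbabilityTheory.cond μ B
  have hWe : ∫⁻ x, (w x : ℝ≥0∞) ∂ν = ENNReal.ofReal (∫ x, (w x : ℝ) ∂ν) := by
    simpa using lintegral_rpow_eq_ofReal hw.measurable hWt zero_le_one le_rfl
  set W := ∫ x, (w x : ℝ) ∂ν with hW
  have hWpos : 0 < W := by
    rw [hWe] at hW0
    simpa using hW0
  set D := Real.log (W / C) with hD
  have hWC : 0 < W / C := by positivity
  have hlow (s : ℝ) (hs : 0 < s) (hs1 : s < 1) : D ≤ ((∫ x, (w x : ℝ) ^ s ∂ν) - 1) / s := by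
    have hA : 0 ≤ ∫ x, (w x : ℝ) ^ s ∂ν := integral_nonneg fun x => by positivity
    have h1 := h' s hs hs1
    rw [hWe, lintegral_rpow_eq_ofReal hw.measurable hWt hs.le hs1.le,
      ENNReal.ofReal_rpow_of_nonneg hA (by positivity), ← ENNReal.ofReal_coe_nnreal,
      ← ENNReal.ofReal_mul C.coe_nonneg, ENNReal.ofReal_le_ofReal_iff (by positivity)] at h1
    have h2 : W / C ≤ (∫ x, (w x : ℝ) ^ s ∂ν) ^ (1 / s) := by
      rw [div_le_iff₀ (by exact_mod_cast hC), mul_comm]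
      exact h1
    have h3 := Real.rpow_le_rpow hWC.le h2 hs.le
    rw [← Real.rpow_mul hA, one_div_mul_cancel hs.ne', Real.rpow_one,
      Real.rpow_def_of_pos hWC, ← hD] at h3
    rw [le_div_iff₀ hs]
    linarith [Real.add_one_le_exp (D * s)]
  let u : ℕ → ℝ := fun n => 1 / (n + 2)
  have hu (n : ℕ) : 0 < u n := by positivity
  have hu1 (n : ℕ) : u n < 1 := by
    simp only [u]
    rw [div_lt_one (by positivity)]
    linarith [(Nat.cast_nonneg n : (0 : ℝ) ≤ n)]
  have hu0 : Filter.Tendsto u Filter.atTop (nhds 0) := by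
    have h1 := (tendsto_one_div_add_atTop_nhds_zero_nat (𝕜 := ℝ)).comp (Filter.tendsto_add_atTop_nat 1)
    refine h1.congr fun n => ?_
    simp only [Function.comp, u]
    push_cast
    ring
  let g : ℕ → X → ℝ≥0∞ := fun n x => ENNReal.ofReal ((w x : ℝ) - 1 - ((w x : ℝ) ^ u n - 1) / u n)
  have hgm (n : ℕ) : Measurable (g n) :=
    ENNReal.measurable_ofReal.comp ((hw.measurable.coe_nnreal_real.sub_const 1).sub
      (((hw.measurable.coe_nnreal_real.pow_const _).sub_const 1).div_const _))
  have hgi (n : ℕ) : ∫⁻ x, g n x ∂ν ≤ ENNReal.ofReal (W - 1 - D) := by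
    have hi := integrable_rpow_coe hw.measurable hWt (hu n).le (hu1 n).le
    have hi1 : Integrable (fun x => (w x : ℝ) - 1) ν := hwi.sub (integrable_const _)
    have hi2 : Integrable (fun x => ((w x : ℝ) ^ u n - 1) / u n) ν :=
      (hi.sub (integrable_const _)).div_const _
    have hnn : 0 ≤ᵐ[ν] fun x => (w x : ℝ) - 1 - ((w x : ℝ) ^ u n - 1) / u n :=
      ae_of_all _ fun x => sub_nonneg.2
        (rpow_sub_one_div_le (w x).coe_nonneg (hu n) (hu1 n).le)
    refine (ofReal_integral_eq_lintegral_ofReal (hi1.sub hi2) hnn).symm.trans_le ?_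
    apply ENNReal.ofReal_le_ofReal
    rw [integral_sub' hi1 hi2, integral_div, integral_sub hi (integrable_const _),
      integral_sub hwi (integrable_const _)]
    simp only [integral_const, probReal_univ, smul_eq_mul, one_mul]
    linarith [hlow _ (hu n) (hu1 n)]
  have hfatou : ∫⁻ x, Filter.liminf (fun n => g n x) Filter.atTop ∂ν ≤
      ENNReal.ofReal (W - 1 - D) :=
    (lintegral_liminf_le hgm).trans (Filter.liminf_le_of_le (by isBoundedDefault) fun b hb => by
      obtain ⟨n, hn⟩ := hb.exists
      exact hn.trans (hgi n))
  have hlim (x : X) (hx : w x ≠ 0) : Filter.liminf (fun n => g n x) Filter.atTop =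
      ENNReal.ofReal ((w x : ℝ) - 1 - Real.log (w x)) :=
    ((ENNReal.continuous_ofReal.tendsto _).comp (tendsto_const_nhds.sub
      (tendsto_rpow_sub_one_div (by exact_mod_cast pos_iff_ne_zero.2 hx) hu hu0))).liminf_eq
  have hlim0 (x : X) (hx : w x = 0) : Filter.liminf (fun n => g n x) Filter.atTop = ∞ := by
    have h1 : Filter.Tendsto (fun n : ℕ => ((n : ℝ≥0∞))) Filter.atTop (nhds ∞) :=
      ENNReal.tendsto_nat_nhds_top
    refine top_unique (h1.liminf_eq.symm.trans_le (Filter.liminf_le_liminf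
      (Filter.Eventually.of_forall fun n => ?_)))
    simp only [g, hx, NNReal.coe_zero, Real.zero_rpow (hu n).ne', u]
    rw [← ENNReal.ofReal_natCast]
    apply ENNReal.ofReal_le_ofReal
    field_simp
    linarith
  have hpos : ∀ᵐ x ∂ν, w x ≠ 0 := by
    filter_upwards [ae_lt_top (Measurable.liminf hgm)
      (ne_top_of_le_ne_top ENNReal.ofReal_ne_top hfatou)] with x hx h0
    rw [hlim0 x h0] at hx
    exact lt_irrefl _ hx
  have hnn (x : X) (hx : w x ≠ 0) : 0 ≤ (w x : ℝ) - 1 - Real.log (w x) :=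
    sub_nonneg.2 (Real.log_le_sub_one_of_pos (by exact_mod_cast pos_iff_ne_zero.2 hx))
  rw [lintegral_congr_ae (hpos.mono hlim)] at hfatou
  have hgint : Integrable (fun x => (w x : ℝ) - 1 - Real.log (w x)) ν := by
    refine ⟨((hw.measurable.coe_nnreal_real.sub_const 1).sub
      (Real.measurable_log.comp hw.measurable.coe_nnreal_real)).aestronglyMeasurable, ?_⟩
    rw [hasFiniteIntegral_iff_ofReal (hpos.mono hnn)]
    exact hfatou.trans_lt ENNReal.ofReal_lt_top
  have hi1 : Integrable (fun x => (w x : ℝ) - 1) ν := hwi.sub (integrable_const _)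
  have hlog : Integrable (fun x => Real.log (w x)) ν := by
    refine (hi1.sub hgint).congr (ae_of_all _ fun x => ?_)
    simp
  rw [← ofReal_integral_eq_lintegral_ofReal hgint (hpos.mono hnn), integral_sub hi1 hlog,
    integral_sub hwi (integrable_const _)] at hfatou
  simp only [integral_const, probReal_univ, smul_eq_mul, one_mul] at hfatou
  have hDW : 0 ≤ W - 1 - D := by
    have h1 := hlow (u 0) (hu 0) (hu1 0)
    have h2 : (∫ x, (w x : ℝ) ^ u 0 ∂ν) - 1 ≤ u 0 * (W - 1) := by
      have hi := integrable_rpow_coe hw.measurable hWt (hu 0).le (hu1 0).le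
      have h3 : ∫ x, (w x : ℝ) ^ u 0 ∂ν ≤ ∫ x, (1 + u 0 * ((w x : ℝ) - 1)) ∂ν := by
        refine integral_mono hi ((integrable_const _).add (hi1.const_mul _)) fun x => ?_
        have := rpow_sub_one_div_le (w x).coe_nonneg (hu 0) (hu1 0).le
        rw [div_le_iff₀ (hu 0)] at this
        change (w x : ℝ) ^ u 0 ≤ 1 + u 0 * ((w x : ℝ) - 1)
        linarith
      rw [integral_add (integrable_const _) (hi1.const_mul _), integral_const_mul,
        integral_sub hwi (integrable_const _)] at h3
      simp only [integral_const, probReal_univ, smul_eq_mul, one_mul] at h3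
      linarith
    rw [le_div_iff₀ (hu 0)] at h1
    have h4 : u 0 * D ≤ u 0 * (W - 1) := by linarith
    linarith [le_of_mul_le_mul_left h4 (hu 0)]
  rw [ENNReal.ofReal_le_ofReal_iff hDW] at hfatou
  rw [hG hpos hlog, hWe, ← ENNReal.ofReal_coe_nnreal, ← ENNReal.ofReal_mul C.coe_nonneg]
  apply ENNReal.ofReal_le_ofReal
  have h1 : W / C ≤ Real.exp (∫ x, Real.log (w x) ∂ν) := by
    rw [← Real.exp_log hWC, ← hD]
    exact Real.exp_le_exp.2 (by linarith)
  rwa [div_le_iff₀ (by exact_mod_cast hC), mul_comm] at h1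

end GeometricMean

/-! ### Counterexamples on disjoint pairs of points -/

universe u

/-- A basis and a weight, with measurable local maximal functions, satisfying `A` but not `B`. -/
def Counterexample (A B : Condition) : Prop :=
  ∃ (X : Type u) (_ : MeasurableSpace X) (μ : Measure X) (_ : SigmaFinite μ)
    (𝓑 : Set (Set X)) (w : X → ℝ≥0), IsBasis μ 𝓑 ∧ IsWeight μ 𝓑 w ∧
    (∀ B ∈ 𝓑, Measurable (localMaximal μ 𝓑 w B)) ∧ A.Holds μ 𝓑 w ∧ ¬ B.Holds μ 𝓑 w

section Atomic

variable {X : Type*} [MeasurableSpace X]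

/-- The measure with an atom of mass `m x` at every point `x`. -/
noncomputable def atomicMeasure (m : X → ℝ≥0) : Measure X :=
  Measure.count.withDensity fun x => (m x : ℝ≥0∞)

variable [MeasurableSingletonClass X] (m : X → ℝ≥0)

instance [Countable X] : SigmaFinite (atomicMeasure m) :=
  SigmaFinite.withDensity m

theorem atomicMeasure_singleton (x : X) : atomicMeasure m {x} = m x := by
  rw [atomicMeasure, withDensity_apply _ (measurableSet_singleton x), lintegral_singleton,
    Measure.count_singleton, mul_one]

end Atomic

/-- Countably many pairs of points. -/
def Pairs : Type u := ULift.{u} (ℕ × Bool)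

namespace Pairs

instance : MeasurableSpace Pairs.{u} := ⊤

instance : DiscreteMeasurableSpace Pairs.{u} := ⟨fun _ => trivial⟩

instance : Countable Pairs.{u} := inferInstanceAs (Countable (ULift (ℕ × Bool)))

/-- The two points of the `n`-th pair. -/
def pt (n : ℕ) (i : Bool) : Pairs.{u} := ⟨(n, i)⟩

/-- The masses `1 - θ n` and `θ n` of the points of the `n`-th pair. -/
noncomputable def measure (θ : ℕ → ℝ≥0) : Measure Pairs.{u} :=
  atomicMeasure fun x => if x.down.2 then θ x.down.1 else 1 - θ x.down.1

instance (θ : ℕ → ℝ≥0) : SigmaFinite (measure.{u} θ) := inferInstanceAs (SigmaFinite (atomicMeasure _))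

/-- The values `a n` and `b n` of the weight on the points of the `n`-th pair. -/
def weight (a b : ℕ → ℝ≥0) (x : Pairs.{u}) : ℝ≥0 :=
  if x.down.2 then b x.down.1 else a x.down.1

/-- The `n`-th pair. -/
def pair (n : ℕ) : Set Pairs.{u} := {pt n false, pt n true}

/-- The basis consisting of the disjoint pairs. -/
def basis : Set (Set Pairs.{u}) := range pair

variable {θ a b : ℕ → ℝ≥0} {n : ℕ}

theorem forall_basis {p : Set Pairs.{u} → Prop} : (∀ B ∈ basis, p B) ↔ ∀ n, p (pair n) :=
  forall_mem_range

@[simp] theorem weight_false : weight a b (pt.{u} n false) = a n := rfl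

@[simp] theorem weight_true : weight a b (pt.{u} n true) = b n := rfl

@[simp] theorem measure_false : measure θ {pt.{u} n false} = (1 - θ n : ℝ≥0) :=
  atomicMeasure_singleton _ _

@[simp] theorem measure_true : measure θ {pt.{u} n true} = θ n :=
  atomicMeasure_singleton _ _

theorem pt_true_mem : pt.{u} n true ∈ pair n := Or.inr rfl

theorem pt_false_mem : pt.{u} n false ∈ pair n := Or.inl rfl

theorem pt_false_ne : pt.{u} n false ≠ pt n true := by
  intro h
  exact Bool.false_ne_true (congrArg (fun x : Pairs.{u} => x.down.2) h)

theorem setLIntegral_pair (f : Pairs.{u} → ℝ≥0∞) :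
    ∫⁻ x in pair n, f x ∂(measure θ) =
      f (pt n false) * (1 - θ n : ℝ≥0) + f (pt n true) * θ n := by
  classical
  have h : pair.{u} n = (({pt n false, pt n true} : Finset Pairs.{u}) : Set Pairs.{u}) := by
    simp [pair]
  rw [h, lintegral_finset, Finset.sum_pair pt_false_ne, measure_false, measure_true]

theorem measure_pair (hθ : θ n ≤ 1) : measure θ (pair.{u} n) = 1 := by
  rw [← setLIntegral_one, setLIntegral_pair, one_mul, one_mul, ← ENNReal.coe_add,
    tsub_add_cancel_of_le hθ, ENNReal.coe_one]

theorem avg_pair (hθ : θ n ≤ 1) (f : Pairs.{u} → ℝ≥0∞) :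
    avg (measure θ) (pair n) f = f (pt n false) * (1 - θ n : ℝ≥0) + f (pt n true) * θ n := by
  rw [avg, measure_pair hθ, div_one, setLIntegral_pair]

theorem wMeas_pair :
    wMeas (measure θ) (weight a b) (pair.{u} n) = (a n * (1 - θ n) + b n * θ n : ℝ≥0) := by
  rw [wMeas, setLIntegral_pair, weight_false, weight_true]
  push_cast
  rfl

theorem wAvg_pair (hθ : θ n ≤ 1) :
    wAvg (measure θ) (weight a b) (pair.{u} n) = (a n * (1 - θ n) + b n * θ n : ℝ≥0) := by
  rw [wAvg, measure_pair hθ, div_one, wMeas_pair]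

theorem avg_weight_pair (hθ : θ n ≤ 1) :
    avg (measure θ) (pair.{u} n) (fun x => (weight a b x : ℝ≥0∞)) =
      (a n * (1 - θ n) + b n * θ n : ℝ≥0) :=
  wAvg_pair hθ

theorem wMeas_true : wMeas (measure θ) (weight a b) {pt.{u} n true} = (b n * θ n : ℝ≥0) := by
  rw [wMeas, lintegral_singleton, weight_true, measure_true, ENNReal.coe_mul]

theorem sep_pair_eq_true {p : Pairs.{u} → Prop} (h1 : p (pt n true)) (h0 : ¬ p (pt n false)) :
    {x ∈ pair n | p x} = {pt n true} := by
  ext x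
  constructor
  · rintro ⟨rfl | rfl, hx⟩
    · exact absurd hx h0
    · rfl
  · rintro rfl
    exact ⟨pt_true_mem, h1⟩

theorem isBasis (hθ : ∀ n, θ n ≤ 1) : IsBasis (measure.{u} θ) basis where
  measurableSet _ _ := .of_discrete
  measure_pos := forall_basis.2 fun n => by rw [measure_pair (hθ n)]; exact one_pos
  measure_lt_top := forall_basis.2 fun n => by rw [measure_pair (hθ n)]; exact ENNReal.one_lt_top
  cover := by
    have : (⋃₀ basis.{u})ᶜ = ∅ := by
      refine compl_empty_iff.2 (eq_univ_of_forall fun x => ⟨pair x.down.1, mem_range_self _, ?_⟩)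
      obtain ⟨n, _ | _⟩ := x
      · exact pt_false_mem
      · exact pt_true_mem
    rw [this, measure_empty]

theorem isWeight (hab : ∀ n, 0 < a n * (1 - θ n) + b n * θ n) :
    IsWeight (measure.{u} θ) basis (weight a b) where
  measurable := .of_discrete
  integral_pos := forall_basis.2 fun n => by rw [wMeas_pair]; exact_mod_cast hab n
  integral_lt_top := forall_basis.2 fun n => by rw [wMeas_pair]; exact ENNReal.coe_lt_top

theorem counterexample {A B : Condition} (hθ : ∀ n, θ n ≤ 1)
    (hab : ∀ n, 0 < a n * (1 - θ n) + b n * θ n) (hA : A.Holds (measure.{u} θ) basis (weight a b))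
    (hB : ¬ B.Holds (measure.{u} θ) basis (weight a b)) : Counterexample.{u} A B :=
  ⟨Pairs, inferInstance, measure θ, inferInstance, basis, weight a b, isBasis hθ, isWeight hab,
    fun _ _ => .of_discrete, hA, hB⟩

end Pairs

open Pairs

theorem half_pow_le_one (n : ℕ) : (1 / 2 : ℝ≥0) ^ n ≤ 1 :=
  pow_le_one₀ zero_le (by norm_num [div_le_one])

theorem counterexample_P1_P6 : Counterexample.{u} .P1 .P6 := by
  have h1 (n : ℕ) : (2 : ℝ≥0) ^ n * (1 / 2) ^ n = 1 := by
    rw [← mul_pow]; norm_num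
  have hS (n : ℕ) : 1 * (1 - (1 / 2) ^ n) + (2 : ℝ≥0) ^ n * (1 / 2) ^ n ≤ 2 := by
    rw [h1, one_mul, ← one_add_one_eq_two]
    gcongr
    exact tsub_le_self
  refine Pairs.counterexample (θ := fun n => (1 / 2) ^ n) (a := fun _ => 1) (b := fun n => 2 ^ n)
    half_pow_le_one (fun n => by rw [h1]; positivity) ?_ ?_
  · refine ⟨2, one_lt_two, 2, two_pos, forall_basis.2 fun n => ?_⟩
    rw [avg_weight_pair (half_pow_le_one n), avg_pair (half_pow_le_one n),
      show (2 : ℝ) - 1 = 1 by norm_num, ENNReal.rpow_one,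
      show 1 - Real.conjExponent 2 = -1 by norm_num [Real.conjExponent]]
    simp only [weight_false, weight_true, ENNReal.coe_one, ENNReal.one_rpow, one_mul]
    calc _ ≤ ((2 : ℝ≥0) : ℝ≥0∞) * (((1 - (1 / 2) ^ n : ℝ≥0) : ℝ≥0∞) + 1 * ((1 / 2) ^ n : ℝ≥0)) := by
          gcongr
          · simpa using hS n
          · rw [ENNReal.rpow_neg_one, ENNReal.inv_le_one]
            exact_mod_cast one_le_pow₀ one_le_two
      _ = 2 := by
          rw [one_mul, ← ENNReal.coe_add, tsub_add_cancel_of_le (half_pow_le_one n)]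
          simp
  · rintro ⟨C, hC, h⟩
    rw [forall_basis] at h
    obtain ⟨n, hn⟩ := exists_nat_gt ((2 * C + 1) / Real.log 2)
    have h2 : 0 < Real.log 2 := Real.log_pos one_lt_two
    rw [div_lt_iff₀ h2] at hn
    have h3 := h n
    rw [setLIntegral_pair, wMeas_pair, wAvg_pair (half_pow_le_one n)] at h3
    simp only [weight_false, weight_true, ENNReal.coe_toReal] at h3
    set S : ℝ≥0 := 1 * (1 - (1 / 2) ^ n) + (2 : ℝ≥0) ^ n * (1 / 2) ^ n with hSdef
    have hS0 : 0 < S := by rw [hSdef, h1]; positivity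
    have h4 : ENNReal.ofReal (n * Real.log 2 - Real.log 2) ≤
        ENNReal.ofReal (Real.posLog (((2 ^ n : ℝ≥0) : ℝ) / S)) := by
      refine ENNReal.ofReal_le_ofReal (le_max_of_le_right ?_)
      rw [NNReal.coe_pow, NNReal.coe_ofNat, Real.log_div (by positivity) (by positivity),
        Real.log_pow]
      gcongr
      exact (NNReal.coe_le_coe.2 (hS n)).trans_eq (by norm_num)
    have h5 : ENNReal.ofReal (n * Real.log 2 - Real.log 2) ≤ (C * 2 : ℝ≥0) := by
      calc _ ≤ _ := h4
        _ = ((2 : ℝ≥0) ^ n : ℝ≥0) * ENNReal.ofReal (Real.posLog (((2 ^ n : ℝ≥0) : ℝ) / S)) *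
            ((1 / 2) ^ n : ℝ≥0) := by
            rw [mul_right_comm, ← ENNReal.coe_mul, h1, ENNReal.coe_one, one_mul]
        _ ≤ _ := le_add_self
        _ ≤ _ := h3
        _ ≤ _ := by
            rw [ENNReal.coe_mul]
            gcongr
            exact hS n
    rw [← ENNReal.ofReal_coe_nnreal, ENNReal.ofReal_le_ofReal_iff (by positivity)] at h5
    push_cast at h5
    have := Real.log_two_lt_d9
    linarith

theorem exists_mul_pow_lt_one (C : ℝ≥0) {ρ : ℝ≥0} (hρ : ρ < 1) :
    ∃ n : ℕ, 1 ≤ n ∧ C * (n + 1) * ρ ^ n < 1 := by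
  have h1 := tendsto_self_mul_const_pow_of_lt_one ρ.coe_nonneg (show (ρ : ℝ) < 1 from hρ)
  have h2 := tendsto_pow_atTop_nhds_zero_of_lt_one ρ.coe_nonneg (show (ρ : ℝ) < 1 from hρ)
  have h3 := (h1.add h2).const_mul (C : ℝ)
  rw [add_zero, mul_zero] at h3
  obtain ⟨n, hn, hn1⟩ := ((h3.eventually_lt_const one_pos).and (Filter.eventually_ge_atTop 1)).exists
  refine ⟨n, hn1, ?_⟩
  rw [← NNReal.coe_lt_coe]
  push_cast
  linarith

theorem half_pow_rpow (δ : ℝ) (k : ℕ) :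
    ((((1 / 2) ^ k : ℝ≥0)) : ℝ≥0∞) ^ δ = (((2 : ℝ≥0) ^ (-δ) : ℝ≥0) : ℝ≥0∞) ^ k := by
  rw [← coe_two_rpow_neg_pow, one_div, inv_pow, ENNReal.coe_inv (by positivity), ENNReal.coe_pow,
    ENNReal.coe_ofNat]

theorem one_div_succ_le_one (n : ℕ) : 1 / ((n : ℝ≥0) + 1) ≤ 1 := by
  rw [div_le_one (by positivity)]
  exact le_add_self

theorem counterexample_P2'_P1' : Counterexample.{u} .P2' .P1' := by
  have hb (n : ℕ) : 0 < (1 / 2 : ℝ≥0) ^ (n + 1) * (1 / (n + 1)) := by positivity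
  refine Pairs.counterexample (θ := fun n => 1 / (n + 1)) (a := fun _ => 1)
    (b := fun n => (1 / 2) ^ (n + 1)) one_div_succ_le_one
    (fun n => (hb n).trans_le le_add_self) ?_ ?_
  · refine ⟨2, two_pos, fun s hs _ => forall_basis.2 fun n => ?_⟩
    have hθ := one_div_succ_le_one n
    rw [avg_weight_pair hθ, avg_pair hθ]
    simp only [weight_false, weight_true, ENNReal.coe_one, ENNReal.one_rpow, one_mul]
    have hle : 1 - 1 / ((n : ℝ≥0) + 1) + (1 / 2) ^ (n + 1) * (1 / (n + 1)) ≤ 1 := by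
      calc _ ≤ 1 - 1 / ((n : ℝ≥0) + 1) + 1 * (1 / (n + 1)) := by
            gcongr
            exact half_pow_le_one _
        _ = 1 := by rw [one_mul, tsub_add_cancel_of_le hθ]
    -- the geometric mean of the weight is `1 / 2` on every pair
    have hgm : ((1 / 2 : ℝ≥0)) ^ s ≤
        1 - 1 / ((n : ℝ≥0) + 1) + ((1 / 2) ^ (n + 1)) ^ s * (1 / (n + 1)) := by
      have h1 := NNReal.geom_mean_le_arith_mean2_weighted (1 - 1 / ((n : ℝ≥0) + 1)) (1 / (n + 1)) 1
        (((1 / 2) ^ (n + 1)) ^ s) (tsub_add_cancel_of_le hθ)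
      rw [NNReal.one_rpow, one_mul, mul_one, ← NNReal.rpow_natCast, ← NNReal.rpow_mul,
        ← NNReal.rpow_mul] at h1
      push_cast at h1
      rw [show ((n : ℝ) + 1) * (s * (1 / (n + 1))) = s by field_simp,
        mul_comm (1 / ((n : ℝ≥0) + 1)), show ((n : ℝ) + 1) = ((n + 1 : ℕ) : ℝ) by push_cast; rfl,
        NNReal.rpow_natCast] at h1
      exact h1
    rw [← ENNReal.coe_rpow_of_nonneg _ hs.le, ← ENNReal.coe_mul, ← ENNReal.coe_add,
      ← ENNReal.coe_rpow_of_nonneg _ (by positivity), ← ENNReal.coe_mul, ENNReal.coe_le_coe]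
    have h2 := NNReal.rpow_le_rpow hgm (show 0 ≤ 1 / s by positivity)
    rw [← NNReal.rpow_mul, mul_one_div_cancel hs.ne', NNReal.rpow_one] at h2
    refine hle.trans (le_trans (by norm_num) (mul_le_mul' le_rfl h2))
  · rintro ⟨δ, hδ, C, hC, h⟩
    rw [forall_basis] at h
    obtain ⟨n, hn1, hn⟩ := exists_mul_pow_lt_one C (two_rpow_neg_lt_one hδ)
    have hθ := one_div_succ_le_one n
    have h1 := h n {pt n true} (singleton_subset_iff.2 pt_true_mem) .of_discrete
    rw [measure_pair hθ, div_one, measure_true, wMeas_true, wMeas_pair] at h1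
    have hS : 1 / 2 ≤ 1 * (1 - 1 / ((n : ℝ≥0) + 1)) + (1 / 2) ^ (n + 1) * (1 / (n + 1)) := by
      rw [one_mul]
      refine le_trans ?_ le_self_add
      refine le_tsub_of_add_le_left ?_
      have : 1 / ((n : ℝ≥0) + 1) ≤ 1 / 2 := by
        gcongr
        rw [← one_add_one_eq_two]
        gcongr
        exact_mod_cast hn1
      exact (add_le_add this le_rfl).trans (add_halves 1).le
    have h2 : (((1 / 2) ^ (n + 1) * (1 / (n + 1)) : ℝ≥0) : ℝ≥0∞) /
        ((1 * (1 - 1 / ((n : ℝ≥0) + 1)) + (1 / 2) ^ (n + 1) * (1 / (n + 1)) : ℝ≥0) : ℝ≥0∞) ≤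
        ((1 / 2) ^ n : ℝ≥0) := by
      refine ENNReal.div_le_of_le_mul ?_
      rw [← ENNReal.coe_mul, ENNReal.coe_le_coe]
      refine (?_ : _ = (1 / 2) ^ n * (1 / 2 * (1 / ((n : ℝ≥0) + 1)))).trans_le ?_
      · rw [pow_succ, mul_assoc]
      · exact mul_le_mul' le_rfl ((mul_le_of_le_one_right' hθ).trans hS)
    have h3 := h1.trans (mul_le_mul' le_rfl (ENNReal.rpow_le_rpow h2 hδ.le))
    rw [half_pow_rpow, ← ENNReal.coe_pow, ← ENNReal.coe_mul, ENNReal.coe_le_coe,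
      div_le_iff₀ (by positivity)] at h3
    rw [mul_right_comm] at hn
    exact absurd h3 (not_le.2 hn)

theorem quarter_le_one : (1 / 4 : ℝ≥0) ≤ 1 := by norm_num [div_le_one]

theorem one_sub_quarter : (1 : ℝ≥0) - 1 / 4 = 3 / 4 := by
  rw [← NNReal.coe_inj, NNReal.coe_sub quarter_le_one]
  norm_num

theorem counterexample_P5_P2' : Counterexample.{u} .P5 .P2' := by
  refine Pairs.counterexample (θ := fun _ => 1 / 4) (a := fun _ => 1) (b := fun _ => 0)
    (fun _ => quarter_le_one) (fun n => by rw [one_sub_quarter]; positivity) ?_ ?_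
  · refine ⟨1, one_pos, forall_basis.2 fun n => ?_⟩
    rw [wAvg_pair quarter_le_one, one_sub_quarter, one_mul (3 / 4 : ℝ≥0), zero_mul, add_zero,
      ENNReal.coe_one, one_mul, median]
    refine le_sInf fun t ht => ?_
    rw [mem_ofPred_eq, measure_pair quarter_le_one] at ht
    have h1 : 1 ≤ t := by
      by_contra! hlt
      have h2 : measure (fun _ => 1 / 4) {pt.{u} n false} ≤ _ := measure_mono
        (singleton_subset_iff.2 (show pt n false ∈ {x ∈ pair n | t < weight (fun _ => 1)
          (fun _ => 0) x} from ⟨pt_false_mem, by simpa using hlt⟩))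
      rw [measure_false, one_sub_quarter] at h2
      have h3 := h2.trans_lt ht
      rw [show (1 / 2 : ℝ≥0∞) = ((1 / 2 : ℝ≥0) : ℝ≥0∞) by simp, ENNReal.coe_lt_coe,
        ← NNReal.coe_lt_coe] at h3
      norm_num at h3
    refine le_trans ?_ h1
    exact_mod_cast (by norm_num [div_le_one] : (3 / 4 : ℝ≥0) ≤ 1)
  · rintro ⟨C, hC, h⟩
    obtain ⟨n, hn1, hn⟩ := exists_mul_pow_lt_one C (ρ := 3 / 4) (by norm_num [div_lt_one])
    have h1 := h (1 / (n + 1)) (by positivity) (by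
      rw [div_lt_one (by positivity)]
      exact lt_add_of_pos_left _ (by exact_mod_cast hn1)) _ (mem_range_self 0)
    have hs : (0 : ℝ) < 1 / (n + 1) := by positivity
    rw [avg_weight_pair quarter_le_one, avg_pair quarter_le_one, one_sub_quarter] at h1
    simp only [weight_false, weight_true, ENNReal.coe_one, ENNReal.one_rpow, one_mul, zero_mul,
      add_zero, ENNReal.coe_zero, ENNReal.zero_rpow_of_pos hs] at h1
    rw [one_div_one_div, show ((n : ℝ) + 1) = ((n + 1 : ℕ) : ℝ) by push_cast; rfl,
      ENNReal.rpow_natCast, ← ENNReal.coe_pow, ← ENNReal.coe_mul, ENNReal.coe_le_coe, pow_succ,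
      ← mul_assoc] at h1
    have h2 : (1 : ℝ≥0) ≤ C * (3 / 4) ^ n := by
      refine le_of_mul_le_mul_right ?_ (show (0 : ℝ≥0) < 3 / 4 by positivity)
      rwa [one_mul]
    refine absurd (h2.trans ?_) (not_le.2 hn)
    rw [mul_right_comm]
    exact le_mul_of_one_le_right' le_add_self

theorem counterexample_P8_P5 : Counterexample.{u} .P8 .P5 := by
  refine Pairs.counterexample (θ := fun _ => 1 / 4) (a := fun _ => 0) (b := fun _ => 1)
    (fun _ => quarter_le_one) (fun n => by positivity) ?_ ?_
  · refine ⟨4, 1, by norm_num, one_pos, forall_basis.2 fun n l hl => ?_⟩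
    rw [wAvg_pair quarter_le_one, zero_mul, zero_add, one_mul, ENNReal.coe_lt_coe] at hl
    have h0 : ¬ l ≤ 0 := not_le.2 (lt_of_le_of_lt zero_le hl)
    by_cases h1 : l ≤ 1
    · simp only [one_mul]
      rw [sep_pair_eq_true (by simpa using h1) (by simpa using h0), wMeas_true, measure_true,
        ← ENNReal.coe_mul, ← ENNReal.coe_mul, ENNReal.coe_le_coe, one_mul, mul_right_comm,
        mul_one_div_cancel (by norm_num), one_mul]
      exact hl.le
    · have : {x ∈ pair.{u} n | l ≤ weight (fun _ => 0) (fun _ => 1) x} = ∅ := by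
        refine eq_empty_of_forall_notMem ?_
        rintro x ⟨rfl | rfl, hx⟩
        · exact h0 hx
        · exact h1 hx
      rw [this, wMeas, setLIntegral_empty]
      exact zero_le
  · rintro ⟨C, hC, h⟩
    have h1 := h _ (mem_range_self 0)
    have h2 : median (measure.{u} fun _ => 1 / 4) (weight (fun _ => 0) fun _ => 1) (pair 0) = 0 := by
      refine le_zero_iff.1 (sInf_le ?_)
      rw [mem_ofPred_eq, sep_pair_eq_true (by simp) (by simp), measure_true,
        measure_pair quarter_le_one, show (1 / 2 : ℝ≥0∞) = ((1 / 2 : ℝ≥0) : ℝ≥0∞) by simp,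
        ENNReal.coe_lt_coe, ← NNReal.coe_lt_coe]
      norm_num
    rw [h2, mul_zero, wAvg_pair quarter_le_one] at h1
    simp at h1

theorem counterexample_P3_P8 : Counterexample.{u} .P3 .P8 := by
  have hθ (n : ℕ) : (1 / 16 : ℝ≥0) ^ n ≤ 1 := pow_le_one₀ zero_le (by norm_num [div_le_one])
  have hbθ (n : ℕ) : (4 : ℝ≥0) ^ n * (1 / 16) ^ n = (1 / 4) ^ n := by
    rw [← mul_pow]; congr 1; rw [← NNReal.coe_inj]; push_cast; norm_num
  have hS1 (n : ℕ) : 1 ≤ 1 * (1 - (1 / 16 : ℝ≥0) ^ n) + 4 ^ n * (1 / 16) ^ n := by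
    calc (1 : ℝ≥0) = 1 - (1 / 16 : ℝ≥0) ^ n + 1 * (1 / 16) ^ n := by
          rw [one_mul, tsub_add_cancel_of_le (hθ n)]
      _ ≤ _ := by
          rw [one_mul (1 - _)]
          gcongr
          exact one_le_pow₀ (by norm_num)
  refine Pairs.counterexample (θ := fun n => (1 / 16) ^ n) (a := fun _ => 1) (b := fun n => 4 ^ n)
    hθ (fun n => one_pos.trans_le (hS1 n)) ?_ ?_
  · refine ⟨2, one_lt_two, 2, two_pos, forall_basis.2 fun n => ?_⟩
    rw [avg_weight_pair (hθ n), avg_pair (hθ n)]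
    simp only [weight_false, weight_true, ENNReal.coe_one, ENNReal.one_rpow, one_mul]
    have h1 : (((4 : ℝ≥0) ^ n : ℝ≥0) : ℝ≥0∞) ^ (2 : ℝ) * ((1 / 16) ^ n : ℝ≥0) = 1 := by
      rw [ENNReal.rpow_two, ← ENNReal.coe_pow, ← ENNReal.coe_mul, ← pow_mul, mul_comm n 2, pow_mul,
        ← mul_pow]
      norm_num
    rw [h1]
    calc _ ≤ (((4 : ℝ≥0) : ℝ≥0∞)) ^ (1 / 2 : ℝ) := by
          refine ENNReal.rpow_le_rpow ?_ (by norm_num)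
          rw [← ENNReal.coe_one, ← ENNReal.coe_add, ENNReal.coe_le_coe]
          calc _ ≤ (1 : ℝ≥0) + 1 := by gcongr; exact tsub_le_self
            _ ≤ 4 := by norm_num
      _ = 2 * 1 := by
          rw [show (4 : ℝ≥0) = 2 ^ 2 by norm_num, ENNReal.coe_pow, ← ENNReal.rpow_natCast,
            ← ENNReal.rpow_mul]
          norm_num
      _ ≤ _ := by
          refine mul_le_mul' (by simp) ?_
          rw [← ENNReal.coe_one, ENNReal.coe_le_coe]
          simpa using hS1 n
  · rintro ⟨C, β, hC, hβ, h⟩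
    rw [forall_basis] at h
    obtain ⟨n, hn⟩ := pow_unbounded_of_one_lt (2 * C + 1 / β + 1) (one_lt_two (α := ℝ≥0))
    have hn1 : 1 ≤ n := by
      by_contra! h0
      obtain rfl : n = 0 := by omega
      rw [pow_zero] at hn
      exact absurd hn (not_lt.2 le_add_self)
    -- the level lies between the mean and the larger value, both by large factors
    have h1 := h n (2 ^ (n + 1)) (by
      rw [wAvg_pair (hθ n), ENNReal.coe_lt_coe, hbθ, one_mul]
      calc _ ≤ (1 : ℝ≥0) + 1 := by
            gcongr
            · exact tsub_le_self
            · exact pow_le_one₀ zero_le (by norm_num [div_le_one])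
        _ = 2 ^ 1 := by norm_num
        _ < 2 ^ (n + 1) := pow_lt_pow_right₀ one_lt_two (by omega))
    have hlt : (1 : ℝ≥0) < 2 ^ (n + 1) := one_lt_pow₀ one_lt_two (by omega)
    have hle : (2 : ℝ≥0) ^ (n + 1) ≤ 4 ^ n := by
      rw [show (4 : ℝ≥0) = 2 ^ 2 by norm_num, ← pow_mul]
      exact pow_le_pow_right₀ one_le_two (by omega)
    have hβn : 1 < β * 2 ^ (n + 1) := by
      have h2 : 1 / β < 2 ^ (n + 1) := by
        calc 1 / β ≤ 2 * C + 1 / β + 1 := by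
              rw [add_right_comm]
              exact le_add_self
          _ < 2 ^ n := hn
          _ ≤ _ := pow_le_pow_right₀ one_le_two (by omega)
      rwa [div_lt_iff₀' hβ] at h2
    have h3 : measure (fun n => (1 / 16) ^ n) {x ∈ pair.{u} n | β * 2 ^ (n + 1) ≤
        weight (fun _ => 1) (fun n => 4 ^ n) x} ≤ ((1 / 16) ^ n : ℝ≥0) := by
      rw [← measure_true.{u}]
      refine measure_mono ?_
      rintro x ⟨rfl | rfl, hx⟩
      · exact absurd hx (not_le.2 (by simpa using hβn))
      · rfl
    rw [sep_pair_eq_true (by simpa using hle) (by simpa using hlt), wMeas_true, hbθ] at h1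
    have h4 := h1.trans (mul_le_mul' le_rfl h3)
    rw [← ENNReal.coe_mul, ← ENNReal.coe_mul, ENNReal.coe_le_coe] at h4
    have h5 := mul_le_mul' h4 (le_refl ((8 : ℝ≥0) ^ n))
    rw [← mul_pow, show C * 2 ^ (n + 1) * (1 / 16) ^ n * 8 ^ n =
      2 * C * (2 * (1 / 16) * 8) ^ n by rw [mul_pow, mul_pow]; ring] at h5
    rw [show (1 / 4 * 8 : ℝ≥0) = 2 by rw [← NNReal.coe_inj]; push_cast; norm_num,
      show (2 * (1 / 16) * 8 : ℝ≥0) = 1 by rw [← NNReal.coe_inj]; push_cast; norm_num,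
      one_pow, mul_one] at h5
    refine absurd (h5.trans ?_) (not_le.2 hn)
    rw [add_assoc]
    exact le_self_add

theorem counterexample_P6_P3' : Counterexample.{u} .P6 .P3' := by
  have hθ0 (n : ℕ) : (1 / 2 : ℝ≥0) ^ (n + 1) / (n + 1) ≤ 1 / (n + 1) := by
    gcongr
    exact half_pow_le_one _
  have hθ (n : ℕ) : (1 / 2 : ℝ≥0) ^ (n + 1) / (n + 1) ≤ 1 := (hθ0 n).trans (one_div_succ_le_one n)
  have hbθ (n : ℕ) : (2 : ℝ≥0) ^ (n + 1) * ((1 / 2) ^ (n + 1) / (n + 1)) = 1 / (n + 1) := by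
    rw [← mul_div_assoc, ← mul_pow]; norm_num
  have hS1 (n : ℕ) : 1 ≤ 1 * (1 - (1 / 2 : ℝ≥0) ^ (n + 1) / (n + 1)) +
      2 ^ (n + 1) * ((1 / 2) ^ (n + 1) / (n + 1)) := by
    rw [hbθ, one_mul]
    calc 1 = 1 - (1 / 2 : ℝ≥0) ^ (n + 1) / (n + 1) + (1 / 2 : ℝ≥0) ^ (n + 1) / (n + 1) :=
          (tsub_add_cancel_of_le (hθ n)).symm
      _ ≤ _ := add_le_add le_rfl (hθ0 n)
  refine Pairs.counterexample (θ := fun n => (1 / 2) ^ (n + 1) / (n + 1)) (a := fun _ => 1)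
    (b := fun n => 2 ^ (n + 1)) hθ (fun n => one_pos.trans_le (hS1 n)) ?_ ?_
  · refine ⟨1, one_pos, forall_basis.2 fun n => ?_⟩
    rw [setLIntegral_pair, wMeas_pair, wAvg_pair (hθ n)]
    have hS := hS1 n
    generalize 1 * (1 - (1 / 2 : ℝ≥0) ^ (n + 1) / (n + 1)) +
      2 ^ (n + 1) * ((1 / 2) ^ (n + 1) / (n + 1)) = S at hS ⊢
    rw [weight_false, weight_true, ENNReal.coe_toReal]
    have hSr : (1 : ℝ) ≤ S := hS
    have h1 : Real.posLog (((1 : ℝ≥0) : ℝ) / S) = 0 := by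
      rw [Real.posLog_eq_zero_iff, NNReal.coe_one, abs_of_nonneg (by positivity)]
      exact (div_le_one (by positivity)).2 hSr
    have h2 : Real.posLog (((2 ^ (n + 1) : ℝ≥0) : ℝ) / S) ≤ ((n + 1 : ℝ≥0) : ℝ) := by
      refine max_le (NNReal.coe_nonneg _) ?_
      calc Real.log (((2 ^ (n + 1) : ℝ≥0) : ℝ) / S) ≤ Real.log (2 ^ (n + 1)) := by
            refine Real.log_le_log (by positivity) ?_
            push_cast
            exact div_le_self (by positivity) hSr
        _ = (n + 1) * Real.log 2 := by rw [Real.log_pow]; push_cast; rfl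
        _ ≤ (n + 1) * 1 := by
            gcongr
            linarith [Real.log_two_lt_d9]
        _ = _ := by push_cast; ring
    have h3 := ENNReal.ofReal_le_ofReal h2
    rw [ENNReal.ofReal_coe_nnreal] at h3
    rw [h1, ENNReal.ofReal_zero, mul_zero, zero_mul, zero_add, ENNReal.coe_one, one_mul]
    calc _ ≤ ((2 ^ (n + 1) : ℝ≥0) : ℝ≥0∞) * (n + 1 : ℝ≥0) * ((1 / 2) ^ (n + 1) / (n + 1) : ℝ≥0) := by
          gcongr
      _ = 1 := by
          rw [← ENNReal.coe_mul, ← ENNReal.coe_mul, mul_right_comm, hbθ,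
            one_div_mul_cancel (by positivity), ENNReal.coe_one]
      _ ≤ S := by exact_mod_cast hS
  · rintro ⟨δ, hδ, C, hC, h⟩
    rw [forall_basis] at h
    obtain ⟨n, hn1, hn⟩ := exists_mul_pow_lt_one (C * 2) (two_rpow_neg_lt_one hδ)
    have h1 := h n {pt n true} (singleton_subset_iff.2 pt_true_mem) .of_discrete
    rw [measure_pair (hθ n), div_one, measure_true, wMeas_true, wMeas_pair, hbθ, one_mul] at h1
    have hS2 : 1 - (1 / 2 : ℝ≥0) ^ (n + 1) / (n + 1) + 1 / (n + 1) ≤ 2 := by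
      rw [← one_add_one_eq_two]
      exact add_le_add tsub_le_self (one_div_succ_le_one n)
    have hθn : (1 / 2 : ℝ≥0) ^ (n + 1) / (n + 1) ≤ (1 / 2) ^ n := by
      refine (div_le_self zero_le le_add_self).trans ?_
      exact pow_le_pow_of_le_one zero_le (by norm_num [div_le_one]) (by omega)
    have h2 : ((1 / (n + 1) / 2 : ℝ≥0) : ℝ≥0∞) ≤ C * (((1 / 2) ^ n : ℝ≥0) : ℝ≥0∞) ^ δ := by
      refine le_trans ?_ (h1.trans (mul_le_mul' le_rfl
        (ENNReal.rpow_le_rpow (ENNReal.coe_le_coe.2 hθn) hδ.le)))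
      rw [ENNReal.coe_div two_ne_zero]
      gcongr
    rw [half_pow_rpow, ← ENNReal.coe_pow, ← ENNReal.coe_mul, ENNReal.coe_le_coe,
      div_le_iff₀ two_pos, div_le_iff₀ (by positivity)] at h2
    refine absurd h2 (not_le.2 ?_)
    convert hn using 1
    ring

theorem counterexample_P7_P4 : Counterexample.{u} .P7 .P4 := by
  refine Pairs.counterexample (θ := fun n => 1 / (n + 1)) (a := fun _ => 0) (b := fun _ => 1)
    one_div_succ_le_one (fun n => by positivity) ?_ ?_
  · refine ⟨1, one_pos, forall_basis.2 fun n => ?_⟩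
    have hθ := one_div_succ_le_one n
    -- the pairs are disjoint, so the maximal function is constant on each of them
    have hM (x : Pairs.{u}) (hx : x ∈ pair n) : localMaximal (measure fun n => 1 / (n + 1)) basis
        (weight (fun _ => 0) fun _ => 1) (pair n) x ≤
        wAvg (measure fun n => 1 / (n + 1)) (weight (fun _ => 0) fun _ => 1) (pair n) := by
      refine iSup₂_le fun B hB => iSup_le fun hxB => ?_
      obtain ⟨k, rfl⟩ := hB
      obtain rfl : k = n := by
        rcases hx with rfl | rfl <;> rcases hxB with h | h <;>
          exact (congrArg (fun x : Pairs.{u} => x.down.1) h).symm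
      rw [avg, setLIntegral_indicator .of_discrete, inter_self]
      exact le_rfl
    calc _ ≤ ∫⁻ x in pair n, wAvg (measure fun n => 1 / (n + 1))
          (weight (fun _ => 0) fun _ => 1) (pair.{u} n) ∂(measure fun n => 1 / (n + 1)) :=
          setLIntegral_mono' .of_discrete hM
      _ = _ := by
          rw [setLIntegral_const, measure_pair hθ, wAvg, measure_pair hθ]
          simp
  · rintro ⟨α, β, hα, -, -, hβ, h⟩
    rw [forall_basis] at h
    obtain ⟨n, hn⟩ := exists_nat_one_div_lt (K := ℝ) (show (0 : ℝ) < α from hα)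
    have hn' : 1 / ((n : ℝ≥0) + 1) < α := by
      rw [← NNReal.coe_lt_coe]
      push_cast
      exact hn
    have h1 := h n {pt n true} (singleton_subset_iff.2 pt_true_mem) .of_discrete (by
      rw [measure_true, measure_pair (one_div_succ_le_one n), mul_one]
      exact_mod_cast hn')
    rw [wMeas_true, wMeas_pair, zero_mul, zero_add, one_mul, ← ENNReal.coe_mul,
      ENNReal.coe_le_coe] at h1
    exact absurd h1 (not_le.2 (mul_lt_of_lt_one_left (by positivity) hβ))

/-! ### A basis with unbounded maximal function -/

/-- Layers of points: the `k`-th layer consists of a core point and `4 ^ k` satellites. -/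
def Layers : Type u := Σ k : ℕ, Option (ULift.{u} (Fin (4 ^ k)))

namespace Layers

instance : MeasurableSpace Layers.{u} := ⊤

instance : DiscreteMeasurableSpace Layers.{u} := ⟨fun _ => trivial⟩

instance : Countable Layers.{u} :=
  inferInstanceAs (Countable (Σ k : ℕ, Option (ULift (Fin (4 ^ k)))))

/-- The core point of the `k`-th layer. -/
def core (k : ℕ) : Layers.{u} := ⟨k, none⟩

/-- The satellites of the `k`-th layer. -/
def satellite (k : ℕ) (i : ULift.{u} (Fin (4 ^ k))) : Layers.{u} := ⟨k, some i⟩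

/-- The core points have mass `4 ^ (-k)`, the satellites `8 ^ (-k)`. The satellites of the `k`-th
layer thus have total mass `2 ^ (-k)`. -/
noncomputable def measure : Measure Layers.{u} :=
  atomicMeasure fun x => x.2.elim ((1 / 4) ^ x.1) fun _ => (1 / 8) ^ x.1

instance : SigmaFinite measure.{u} := inferInstanceAs (SigmaFinite (atomicMeasure _))

/-- The weight is `2 ^ k` at the core points and `1` at the satellites. -/
def weight (x : Layers.{u}) : ℝ≥0 := x.2.elim (2 ^ x.1) fun _ => 1

/-- A cell consists of the core point and one satellite of a layer. -/
def cell (k : ℕ) (i : ULift.{u} (Fin (4 ^ k))) : Set Layers.{u} := {core k, satellite k i}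

/-- The basis of the whole space and all cells. -/
def basis : Set (Set Layers.{u}) := {B | B = univ ∨ ∃ k i, cell k i = B}

theorem forall_basis {p : Set Layers.{u} → Prop} :
    (∀ B ∈ basis, p B) ↔ p univ ∧ ∀ k i, p (cell k i) := by
  constructor
  · exact fun h => ⟨h _ (Or.inl rfl), fun k i => h _ (Or.inr ⟨k, i, rfl⟩)⟩
  · rintro ⟨h1, h2⟩ B (rfl | ⟨k, i, rfl⟩)
    · exact h1
    · exact h2 k i

variable {k : ℕ} {i : ULift.{u} (Fin (4 ^ k))}

@[simp] theorem weight_core : weight (core.{u} k) = 2 ^ k := rfl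

@[simp] theorem weight_satellite : weight (satellite k i) = 1 := rfl

@[simp] theorem measure_core : measure {core.{u} k} = ((1 / 4) ^ k : ℝ≥0) :=
  atomicMeasure_singleton _ _

@[simp] theorem measure_satellite : measure {satellite k i} = ((1 / 8) ^ k : ℝ≥0) :=
  atomicMeasure_singleton _ _

theorem one_le_weight (x : Layers.{u}) : 1 ≤ weight x := by
  obtain ⟨k, _ | i⟩ := x
  · exact one_le_pow₀ one_le_two
  · exact le_rfl

theorem core_ne_satellite : core k ≠ satellite k i := by
  intro h
  exact Bool.false_ne_true (congrArg (fun x : Layers.{u} => x.2.isSome) h)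

theorem setLIntegral_cell (f : Layers.{u} → ℝ≥0∞) :
    ∫⁻ x in cell k i, f x ∂measure =
      f (core k) * ((1 / 4) ^ k : ℝ≥0) + f (satellite k i) * ((1 / 8) ^ k : ℝ≥0) := by
  classical
  have h : cell k i = (({core k, satellite k i} : Finset Layers.{u}) : Set Layers.{u}) := by
    simp [cell]
  rw [h, lintegral_finset, Finset.sum_pair core_ne_satellite, measure_core, measure_satellite]

theorem lintegral_eq_tsum (f : Layers.{u} → ℝ≥0∞) :
    ∫⁻ x, f x ∂measure = ∑' k : ℕ, (f (core k) * ((1 / 4) ^ k : ℝ≥0) +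
      (∑ i, f (satellite k i)) * ((1 / 8) ^ k : ℝ≥0)) := by
  rw [lintegral_countable']
  refine (ENNReal.tsum_sigma' fun x : Layers.{u} => f x * measure {x}).trans ?_
  refine tsum_congr fun k => ?_
  rw [tsum_fintype, Fintype.sum_option, Finset.sum_mul]
  congr 1
  · exact congrArg _ measure_core
  · exact Finset.sum_congr rfl fun i _ => congrArg _ measure_satellite

theorem four_pow_mul_eighth_pow (k : ℕ) : (4 : ℝ≥0∞) ^ k * ((1 / 8) ^ k : ℝ≥0) = ((1 / 2) ^ k : ℝ≥0) := by
  rw [show (4 : ℝ≥0∞) = ((4 : ℝ≥0) : ℝ≥0∞) from rfl, ← ENNReal.coe_pow, ← ENNReal.coe_mul, ← mul_pow]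
  congr 2
  rw [← NNReal.coe_inj]; push_cast; norm_num

theorem two_pow_mul_quarter_pow (k : ℕ) : (2 : ℝ≥0) ^ k * (1 / 4) ^ k = (1 / 2) ^ k := by
  rw [← mul_pow]
  congr 1
  rw [← NNReal.coe_inj]; push_cast; norm_num

theorem tsum_half_pow : ∑' k : ℕ, (((1 / 2) ^ k : ℝ≥0) : ℝ≥0∞) = 2 := by
  simp_rw [ENNReal.coe_pow]
  rw [ENNReal.tsum_geometric]
  simp [ENNReal.one_sub_inv_two]

theorem tsum_le_two_mul_half_pow {g : ℕ → ℝ≥0∞} {n : ℕ} (h0 : ∀ j < n, g j = 0)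
    (h : ∀ j, g j ≤ ((1 / 2) ^ j : ℝ≥0)) : ∑' j, g j ≤ (2 * (1 / 2) ^ n : ℝ≥0) := by
  rw [← Summable.sum_add_tsum_nat_add' (f := g) (k := n) ENNReal.summable,
    Finset.sum_eq_zero fun j hj => h0 j (Finset.mem_range.1 hj), zero_add]
  calc _ ≤ ∑' j : ℕ, (((1 / 2) ^ n : ℝ≥0) : ℝ≥0∞) * ((1 / 2) ^ j : ℝ≥0) := by
        refine ENNReal.tsum_le_tsum fun j => (h _).trans_eq ?_
        rw [← ENNReal.coe_mul, ← pow_add, add_comm]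
    _ = _ := by
        rw [ENNReal.tsum_mul_left, tsum_half_pow, mul_comm, ENNReal.coe_mul, ENNReal.coe_ofNat]

theorem wMeas_univ : wMeas measure weight (univ : Set Layers.{u}) = 4 := by
  rw [wMeas, Measure.restrict_univ, lintegral_eq_tsum]
  have h (k : ℕ) : (weight (core.{u} k) : ℝ≥0∞) * ((1 / 4) ^ k : ℝ≥0) +
      (∑ i, (weight (satellite.{u} k i) : ℝ≥0∞)) * ((1 / 8) ^ k : ℝ≥0) =
      2 * ((1 / 2) ^ k : ℝ≥0) := by
    simp only [weight_core, weight_satellite, Finset.sum_const, Finset.card_univ,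
      Fintype.card_ulift, Fintype.card_fin, nsmul_eq_mul, ENNReal.coe_one, mul_one]
    rw [← ENNReal.coe_mul, two_pow_mul_quarter_pow, Nat.cast_pow, Nat.cast_ofNat,
      four_pow_mul_eighth_pow, two_mul]
  simp_rw [h]
  rw [ENNReal.tsum_mul_left, tsum_half_pow]
  norm_num

theorem one_le_measure_univ : 1 ≤ measure (univ : Set Layers.{u}) := by
  refine le_trans ?_ (measure_mono (subset_univ {core 0}))
  rw [measure_core]; simp

theorem measure_univ_lt_top : measure (univ : Set Layers.{u}) < ∞ := by
  refine lt_of_le_of_lt ?_ (show (4 : ℝ≥0∞) < ∞ by simp)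
  rw [← wMeas_univ.{u}, wMeas, ← setLIntegral_one]
  exact lintegral_mono fun x => ENNReal.one_le_coe_iff.2 (one_le_weight x)

theorem measure_cell : measure (cell k i) = ((1 / 4) ^ k + (1 / 8) ^ k : ℝ≥0) := by
  rw [← setLIntegral_one, setLIntegral_cell, one_mul, one_mul, ENNReal.coe_add]

theorem measure_cell_le : measure (cell k i) ≤ (2 * (1 / 4) ^ k : ℝ≥0) := by
  rw [measure_cell, ENNReal.coe_le_coe, two_mul]
  gcongr
  norm_num

theorem wMeas_core : wMeas measure weight {core.{u} k} = ((1 / 2) ^ k : ℝ≥0) := by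
  rw [wMeas, lintegral_singleton, measure_core, weight_core, ← ENNReal.coe_mul,
    two_pow_mul_quarter_pow]

theorem isBasis : IsBasis measure basis.{u} where
  measurableSet _ _ := .of_discrete
  measure_pos := forall_basis.2 ⟨one_pos.trans_le one_le_measure_univ, fun k i => by
    rw [measure_cell, ENNReal.coe_pos]; positivity⟩
  measure_lt_top := forall_basis.2 ⟨measure_univ_lt_top, fun k i => by
    rw [measure_cell]; exact ENNReal.coe_lt_top⟩
  cover := by
    have : (⋃₀ basis.{u})ᶜ = ∅ :=
      compl_empty_iff.2 (eq_univ_of_forall fun x => ⟨univ, Or.inl rfl, mem_univ _⟩)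
    rw [this, measure_empty]

theorem measure_le_wMeas (B : Set Layers.{u}) : measure B ≤ wMeas measure weight B := by
  rw [wMeas, ← setLIntegral_one]
  exact lintegral_mono fun x => ENNReal.one_le_coe_iff.2 (one_le_weight x)

theorem isWeight : IsWeight measure basis weight.{u} where
  measurable := .of_discrete
  integral_pos B hB := (isBasis.measure_pos B hB).trans_le (measure_le_wMeas B)
  integral_lt_top := forall_basis.2 ⟨by rw [wMeas_univ]; simp, fun k i => by
    rw [wMeas, setLIntegral_cell]
    exact ENNReal.add_lt_top.2 ⟨ENNReal.mul_lt_top (by simp) ENNReal.coe_lt_top,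
      ENNReal.mul_lt_top (by simp) ENNReal.coe_lt_top⟩⟩

theorem one_le_wAvg {B : Set Layers.{u}} (hB : B ∈ basis) : 1 ≤ wAvg measure weight B := by
  rw [wAvg, ENNReal.le_div_iff_mul_le (Or.inl (isBasis.measure_pos B hB).ne')
    (Or.inl (isBasis.measure_lt_top B hB).ne), one_mul]
  exact measure_le_wMeas B

theorem le_wAvg_cell : ((2 ^ k / 2 : ℝ≥0) : ℝ≥0∞) ≤ wAvg measure weight (cell k i) := by
  have hB : cell k i ∈ basis := Or.inr ⟨k, i, rfl⟩
  rw [wAvg, ENNReal.le_div_iff_mul_le (Or.inl (isBasis.measure_pos _ hB).ne')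
    (Or.inl (isBasis.measure_lt_top _ hB).ne)]
  calc _ ≤ ((2 ^ k / 2 : ℝ≥0) : ℝ≥0∞) * (2 * (1 / 4) ^ k : ℝ≥0) := by
        gcongr
        exact measure_cell_le
    _ = wMeas measure weight {core.{u} k} := by
        rw [wMeas_core, ← ENNReal.coe_mul, ← two_pow_mul_quarter_pow]
        congr 1
        ring
    _ ≤ _ := lintegral_mono_set (singleton_subset_iff.2 (Or.inl rfl))

theorem holds_P1 : Condition.P1.Holds measure basis weight.{u} := by
  refine ⟨2, one_lt_two, 4, by norm_num, ?_⟩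
  rw [show (2 : ℝ) - 1 = 1 by norm_num, show 1 - Real.conjExponent 2 = -1 by
    norm_num [Real.conjExponent]]
  simp only [ENNReal.rpow_one, ENNReal.rpow_neg_one]
  refine forall_basis.2 ⟨?_, fun k i => ?_⟩
  · have h1 : avg measure univ (fun x : Layers.{u} => (weight x : ℝ≥0∞)) ≤ 4 := by
      refine ENNReal.div_le_of_le_mul ?_
      change wMeas measure weight univ ≤ _
      rw [wMeas_univ]
      exact le_mul_of_one_le_right' one_le_measure_univ
    have h2 : avg measure univ (fun x : Layers.{u} => (weight x : ℝ≥0∞)⁻¹) ≤ 1 := by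
      refine ENNReal.div_le_of_le_mul ?_
      rw [one_mul, ← setLIntegral_one]
      exact lintegral_mono fun x => ENNReal.inv_le_one.2 (ENNReal.one_le_coe_iff.2 (one_le_weight x))
    exact (mul_le_mul' h1 h2).trans (by simp)
  · have hB : cell k i ∈ basis := Or.inr ⟨k, i, rfl⟩
    have hμ0 := (isBasis.measure_pos _ hB).ne'
    have h1 : avg measure (cell k i) (fun x : Layers.{u} => (weight x : ℝ≥0∞)) ≤ (2 ^ k : ℝ≥0) := by
      refine ENNReal.div_le_of_le_mul ?_
      rw [← setLIntegral_const]
      refine setLIntegral_mono' .of_discrete fun x hx => ENNReal.coe_le_coe.2 ?_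
      rcases hx with rfl | rfl
      · exact le_rfl
      · exact one_le_pow₀ one_le_two
    have h2 : avg measure (cell k i) (fun x : Layers.{u} => (weight x : ℝ≥0∞)⁻¹) ≤
        (2 * (1 / 2) ^ k : ℝ≥0) := by
      refine ENNReal.div_le_of_le_mul ?_
      rw [setLIntegral_cell, measure_cell, weight_core, weight_satellite,
        ← ENNReal.coe_inv (by positivity), ENNReal.coe_one, inv_one, one_mul, ← ENNReal.coe_mul,
        ← ENNReal.coe_add, ← ENNReal.coe_mul, ENNReal.coe_le_coe]
      have e : (1 / 8 : ℝ≥0) ^ k = (1 / 2) ^ k * (1 / 4) ^ k := by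
        rw [← mul_pow]; congr 1; rw [← NNReal.coe_inj]; push_cast; norm_num
      rw [← inv_pow, ← one_div, e]
      calc _ = 2 * (1 / 2 : ℝ≥0) ^ k * (1 / 4) ^ k := by ring
        _ ≤ _ := by gcongr; exact le_self_add
    refine (mul_le_mul' h1 h2).trans ?_
    rw [← ENNReal.coe_mul, ENNReal.coe_le_coe, mul_left_comm, ← mul_pow]
    norm_num

/-- On the whole space, a level between `2 ^ (n - 1)` and `2 ^ n` leaves only core points of the
layers from `n` on; their weight `2 ^ (1 - n)` is comparable to the level times `4 ^ (-n)`. -/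
theorem holds_P8 : Condition.P8.Holds measure basis weight.{u} := by
  refine ⟨4, 1, by norm_num, one_pos, ?_⟩
  simp only [one_mul]
  refine forall_basis.2 ⟨fun l hl => ?_, fun k i l hl => ?_⟩
  · have hl1 : 1 < l := by
      have := (one_le_wAvg (Or.inl rfl)).trans_lt hl
      exact_mod_cast this
    have hex : ∃ K : ℕ, l ≤ 2 ^ K := (pow_unbounded_of_one_lt l one_lt_two).imp fun _ h => h.le
    classical
    -- only the core points of the layers from `K` on have weight at least `l`
    obtain ⟨K, hK, hK'⟩ : ∃ K : ℕ, l ≤ 2 ^ (K + 1) ∧ 2 ^ K < l := by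
      have h0 : Nat.find hex ≠ 0 := fun h => by
        have := Nat.find_spec hex
        rw [h, pow_zero] at this
        exact absurd hl1 (not_lt.2 this)
      obtain ⟨K, hK⟩ := Nat.exists_eq_succ_of_ne_zero h0
      refine ⟨K, ?_, ?_⟩
      · have := Nat.find_spec hex
        rwa [hK] at this
      · exact not_le.1 (Nat.find_min hex (by omega))
    have h1 : wMeas measure weight {x : Layers.{u} | x ∈ univ ∧ l ≤ weight x} ≤
        (2 * (1 / 2) ^ (K + 1) : ℝ≥0) := by
      rw [wMeas, ← lintegral_indicator .of_discrete, lintegral_eq_tsum]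
      have hsat (j : ℕ) (i : ULift.{u} (Fin (4 ^ j))) :
          {x : Layers.{u} | x ∈ univ ∧ l ≤ weight x}.indicator (fun x => (weight x : ℝ≥0∞))
            (satellite j i) = 0 :=
        indicator_of_notMem (fun h => absurd hl1 (not_lt.2 h.2)) _
      have hcore (j : ℕ) (hj : j < K + 1) :
          {x : Layers.{u} | x ∈ univ ∧ l ≤ weight x}.indicator (fun x => (weight x : ℝ≥0∞))
            (core j) = 0 := by
        refine indicator_of_notMem (fun h => absurd (hK'.trans_le h.2) (not_lt.2 ?_)) _
        exact pow_le_pow_right₀ one_le_two (Nat.lt_succ_iff.1 hj)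
      simp_rw [hsat, Finset.sum_const_zero, zero_mul, add_zero]
      refine tsum_le_two_mul_half_pow (fun j hj => by rw [hcore j hj, zero_mul]) fun j => ?_
      refine (mul_le_mul' (indicator_le_self _ _ _) le_rfl).trans_eq ?_
      rw [weight_core, ← ENNReal.coe_mul, two_pow_mul_quarter_pow]
    refine h1.trans ?_
    calc ((2 * (1 / 2) ^ (K + 1) : ℝ≥0) : ℝ≥0∞)
        = ((4 : ℝ≥0) : ℝ≥0∞) * ((2 ^ K : ℝ≥0) : ℝ≥0∞) * measure {core.{u} (K + 1)} := by
          rw [measure_core, ← ENNReal.coe_mul, ← ENNReal.coe_mul, ← two_pow_mul_quarter_pow]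
          congr 1
          ring
      _ ≤ _ := by
          gcongr
          rintro x rfl
          exact ⟨mem_univ _, hK⟩
  · have hl1 : 1 < l := by
      have := (one_le_wAvg (Or.inr ⟨k, i, rfl⟩)).trans_lt hl
      exact_mod_cast this
    have hl2 : 2 ^ k / 2 < l := by
      have := le_wAvg_cell.trans_lt hl
      exact_mod_cast this
    by_cases hlk : l ≤ 2 ^ k
    · have hset : {x ∈ cell k i | l ≤ weight x} = {core k} := by
        ext x
        constructor
        · rintro ⟨rfl | rfl, hx⟩
          · rfl
          · exact absurd hl1 (not_lt.2 hx)
        · rintro rfl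
          exact ⟨Or.inl rfl, hlk⟩
      rw [hset, wMeas_core, measure_core, ← ENNReal.coe_mul, ← ENNReal.coe_mul,
        ENNReal.coe_le_coe, ← two_pow_mul_quarter_pow]
      gcongr
      rw [div_lt_iff₀ two_pos] at hl2
      refine hl2.le.trans ?_
      rw [mul_comm]
      gcongr
      norm_num
    · have hset : {x ∈ cell k i | l ≤ weight x} = ∅ := by
        refine eq_empty_of_forall_notMem ?_
        rintro x ⟨rfl | rfl, hx⟩
        · exact hlk hx
        · exact absurd hl1 (not_lt.2 hx)
      rw [hset, wMeas, setLIntegral_empty]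
      exact zero_le

/-- On the satellites of the `k`-th layer, of total mass `2 ^ (-k)`, the maximal function is at
least `2 ^ k / 2`, so every layer contributes at least `1 / 2` to its integral. -/
theorem not_holds_P7 : ¬ Condition.P7.Holds measure basis weight.{u} := by
  rintro ⟨C, hC, h⟩
  have h1 := h univ (Or.inl rfl)
  rw [wMeas_univ, Measure.restrict_univ, lintegral_eq_tsum] at h1
  have h2 (k : ℕ) : (2 : ℝ≥0∞)⁻¹ ≤ localMaximal measure basis weight.{u} univ (core k) *
      ((1 / 4) ^ k : ℝ≥0) + (∑ i, localMaximal measure basis weight.{u} univ (satellite k i)) *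
      ((1 / 8) ^ k : ℝ≥0) := by
    refine le_trans ?_ le_add_self
    have h3 (i : ULift.{u} (Fin (4 ^ k))) : ((2 ^ k / 2 : ℝ≥0) : ℝ≥0∞) ≤
        localMaximal measure basis weight.{u} univ (satellite k i) := by
      refine (le_wAvg_cell (i := i)).trans ?_
      rw [localMaximal, indicator_univ]
      exact le_iSup₂_of_le (cell k i) (Or.inr ⟨k, i, rfl⟩)
        (le_iSup_of_le (show satellite k i ∈ cell k i from Or.inr rfl) le_rfl)
    refine le_trans ?_ (mul_le_mul' (Finset.sum_le_sum fun i _ => h3 i) le_rfl)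
    rw [Finset.sum_const, Finset.card_univ, Fintype.card_ulift, Fintype.card_fin, nsmul_eq_mul,
      Nat.cast_pow, Nat.cast_ofNat, mul_right_comm, four_pow_mul_eighth_pow, ← ENNReal.coe_mul,
      ← mul_div_assoc, ← mul_pow]
    norm_num
  have h3 := (ENNReal.tsum_le_tsum h2).trans h1
  rw [ENNReal.tsum_const_eq_top_of_ne_zero (by simp)] at h3
  exact absurd h3 (not_le.2 (ENNReal.mul_lt_top ENNReal.coe_lt_top (by simp)))

theorem counterexample {A : Condition} (hA : A.Holds measure basis weight.{u}) :
    Counterexample.{u} A .P7 :=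
  ⟨Layers, inferInstance, measure, inferInstance, basis, weight, isBasis, isWeight,
    fun _ _ => .of_discrete, hA, not_holds_P7⟩

end Layers

/-! ### The table of implications -/

section Table

variable {X : Type*} [MeasurableSpace X] {μ : Measure X} {𝓑 : Set (Set X)} {w : X → ℝ≥0}

theorem holds_base_iff (h𝓑 : IsBasis μ 𝓑) (hw : IsWeight μ 𝓑 w) (A : Condition) :
    A.base.Holds μ 𝓑 w ↔ A.Holds μ 𝓑 w := by
  cases A
  case P1' => exact ⟨holds_P1'_of_P1 h𝓑 hw, holds_P1_of_P1' h𝓑 hw⟩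
  case P2' => exact ⟨holds_P2'_of_P2 h𝓑 hw, holds_P2_of_P2' h𝓑 hw⟩
  case P3' => exact ⟨holds_P3'_of_P3 h𝓑 hw, holds_P3_of_P3' h𝓑 hw⟩
  case P4' => exact ⟨holds_P4'_of_P4 h𝓑 hw, holds_P4_of_P4' h𝓑 hw⟩
  all_goals exact Iff.rfl

theorem holds_of_tableEntry (h𝓑 : IsBasis μ 𝓑) (hw : IsWeight μ 𝓑 w) {A B : Condition}
    (hAB : A.TableEntry B) (hA : A.Holds μ 𝓑 w) : B.Holds μ 𝓑 w := by
  rw [← holds_base_iff h𝓑 hw] at hA ⊢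
  have h12 := fun h => holds_P2_of_P2' h𝓑 hw (holds_P2'_of_P1 h𝓑 hw h)
  have h25 := fun h => holds_P5_of_P2' h𝓑 hw (holds_P2'_of_P2 h𝓑 hw h)
  have h54 := holds_P4_of_P5 h𝓑 hw
  have h83 := holds_P3_of_P8 h𝓑 hw
  have h36 := holds_P6_of_P3 h𝓑 hw
  have h64 := holds_P4_of_P6 h𝓑 hw
  rw [Condition.TableEntry, Condition.row] at hAB
  generalize A.base = A' at hA hAB
  generalize B.base = B' at hAB ⊢
  cases A' <;> simp only [mem_insert_iff, mem_singleton_iff, mem_empty_iff_false] at hAB <;>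
    rcases hAB with rfl | rfl | rfl | rfl <;> tauto

theorem Counterexample.mono {A B A' B' : Condition} (h : Counterexample.{u} A B)
    (hA : A.TableEntry A') (hB : B'.TableEntry B) : Counterexample.{u} A' B' := by
  obtain ⟨X, _, μ, hμ, 𝓑, w, h𝓑, hw, hm, h1, h2⟩ := h
  exact ⟨X, _, μ, hμ, 𝓑, w, h𝓑, hw, hm, holds_of_tableEntry h𝓑 hw hA h1,
    fun h => h2 (holds_of_tableEntry h𝓑 hw hB h)⟩

/-- Every pair outside the table is refuted by one of nine counterexamples: some weight satisfies a
condition implying `A` and violates a condition implied by `B`. -/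
theorem counterexample_of_not_tableEntry {A B : Condition} (h : ¬ A.TableEntry B) :
    Counterexample.{u} A B := by
  rw [Condition.TableEntry] at h
  -- the alternatives either find the pair in the table or select one of the nine
  cases A <;> cases B <;> first
    | (refine (h ?_).elim; simp [Condition.row, Condition.base]; done)
    | (apply Counterexample.mono counterexample_P1_P6 <;>
        simp [Condition.TableEntry, Condition.row, Condition.base]; done)
    | (apply Counterexample.mono (Layers.counterexample Layers.holds_P1) <;>
        simp [Condition.TableEntry, Condition.row, Condition.base]; done)
    | (apply Counterexample.mono (Layers.counterexample Layers.holds_P8) <;>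
        simp [Condition.TableEntry, Condition.row, Condition.base]; done)
    | (apply Counterexample.mono counterexample_P2'_P1' <;>
        simp [Condition.TableEntry, Condition.row, Condition.base]; done)
    | (apply Counterexample.mono counterexample_P5_P2' <;>
        simp [Condition.TableEntry, Condition.row, Condition.base]; done)
    | (apply Counterexample.mono counterexample_P8_P5 <;>
        simp [Condition.TableEntry, Condition.row, Condition.base]; done)
    | (apply Counterexample.mono counterexample_P3_P8 <;>
        simp [Condition.TableEntry, Condition.row, Condition.base]; done)
    | (apply Counterexample.mono counterexample_P6_P3' <;>
        simp [Condition.TableEntry, Condition.row, Condition.base]; done)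
    | (apply Counterexample.mono counterexample_P7_P4 <;>
        simp [Condition.TableEntry, Condition.row, Condition.base])

end Table

end AInfinity

theorem theorem1 (PA PB : AInfinity.Condition) :
    (PA.TableEntry PB →
      ∀ (X : Type*) [MeasurableSpace X] (μ : Measure X) [SigmaFinite μ] (𝓑 : Set (Set X))
        (w : X → ℝ≥0), AInfinity.IsBasis μ 𝓑 → AInfinity.IsWeight μ 𝓑 w →
        PA.Holds μ 𝓑 w → PB.Holds μ 𝓑 w) ∧
    (¬ PA.TableEntry PB →
      ∃ (X : Type*) (_ : MeasurableSpace X) (μ : Measure X) (_ : SigmaFinite μ)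
        (𝓑 : Set (Set X)) (w : X → ℝ≥0), AInfinity.IsBasis μ 𝓑 ∧ AInfinity.IsWeight μ 𝓑 w ∧
        (∀ B ∈ 𝓑, Measurable (AInfinity.localMaximal μ 𝓑 w B)) ∧
        PA.Holds μ 𝓑 w ∧ ¬ PB.Holds μ 𝓑 w) :=
  ⟨fun h _ _ _ _ _ _ h𝓑 hw => AInfinity.holds_of_tableEntry h𝓑 hw h,
    fun h => AInfinity.counterexample_of_not_tableEntry h⟩
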